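/- Let $\mathbb{T}=\mathbb{R}/(2\pi\mathbb{Z})$ and, for $a\in\mathbb{R}$, let $e^{-ia\Delta}$ be the unitary operator on $L^2(\mathbb{T})$ given by $\widehat{e^{-ia\Delta}f}(k)=e^{iak^2}\hat f(k)$, $k\in\mathbb{Z}$. Let $(W_t)_{t\ge 0}$ be a standard real Brownian motion with respect to a filtration $(\mathcal{F}_t)_{t\ge0}$ on a probability space $\Omega$ (that is, $W$ is adapted and $W_t-W_s$ is independent of $\mathcal{F}_s$ for $s\le t$), and let $T>0$. For $b\geq 0$ and a Hilbert space $B$, let $H^b(\mathbb{R};B)$ have the norm $\|g\|_{H^b(\mathbb{R};B)}=\|\langle D\rangle^b g\|_{L^2(\mathbb{R};B)}$, where $\langle D\rangle=(1-\partial_t^2)^{1/2}$, and let $H^b(0,T;B)$ be the space of restrictions to $(0,T)$ of elements of $H^b(\mathbb{R};B)$, with the norm $\|f\|_{H^b(0,T;B)}=\inf\{\|g\|_{H^b(\mathbb{R};B)} : g=f \text{ a.e. on }(0,T)\}$. Let $X^{0,b}_4(T)$ be the space of all processes $u(t)=e^{-iW_t\Delta}\psi(t)$, $0<t<T$, such that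 $\psi$ is (up to equality almost everywhere) a predictable process with values in $L^2(\mathbb{T})$ and $$\|u\|_{X^{0,b}_4(T)}:=\|\psi\|_{L^4_\omega H^b_t(0,T;L^2_x)}=\Big(\mathbb{E}\,\|\psi\|_{H^b(0,T;L^2(\mathbb{T}))}^4\Big)^{1/4}<\infty .$$ Let $L^4_\omega L^4_TL^4_x$ be the space of (up to equality almost everywhere) predictable processes $u$ on $(0,T)$ with values in $L^4(\mathbb{T})$ such that $$\|u\|_{L^4_\omega L^4_TL^4_x}:=\Big(\mathbb{E}\int_0^T\|u(t)\|_{L^4(\mathbb{T})}^4\,dt\Big)^{1/4}<\infty .$$ **Theorem.** For every $b>5/16$ there is a constant $C$, depending only on $b$ (in particular, neither on $T$ nor on the probability space), such that every $u\in X^{0,b}_4(T)$ belongs to $L^4_\omega L^4_TL^4_x$, with $$\|u\|_{L^4_\omega L^4_TL^4_x}\le C\,\|u\|_{X^{0,b}_4(T)} .$$ -/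

import Mathlib

open MeasureTheory ProbabilityTheory Set
open scoped NNReal ENNReal

noncomputable section

namespace StochasticFourierRestriction

/-- The circle `𝕋 = ℝ / 2πℤ`. -/
abbrev Torus : Type := AddCircle (2 * Real.pi)

instance : Fact (0 < 2 * Real.pi) := ⟨Real.two_pi_pos⟩

/-- The measure on `𝕋` that is used for the spatial Lebesgue norms: the normalized Lebesgue measure
`dx / 2π`. Compared with `dx`, it changes each norm only by a fixed power of `2π`. -/
abbrev torusMeasure : Measure Torus := AddCircle.haarAddCircle

/-- `L²(𝕋)`. -/
abbrev L2x : Type := Lp ℂ 2 torusMeasure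

/-- `L⁴(𝕋)`. -/
abbrev L4x : Type := Lp ℂ 4 torusMeasure

instance : Fact ((1 : ℝ≥0∞) ≤ 4) := ⟨by norm_num⟩

/-! ### The Schrödinger group -/

theorem memℓp_phase_mul (a : ℝ) (c : lp (fun _ : ℤ => ℂ) 2) :
    Memℓp (fun k : ℤ => Complex.exp (Complex.I * (k : ℂ) ^ 2 * a) * c k) 2 := by
  refine (memℓp_gen_iff (by norm_num)).2 ?_
  have h := (memℓp_gen_iff (p := 2) (by norm_num)).1 (lp.memℓp c)
  refine h.congr fun k => ?_
  have : Complex.I * (k : ℂ) ^ 2 * a = (((k : ℝ) ^ 2 * a : ℝ) : ℂ) * Complex.I := by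
    push_cast; ring
  rw [norm_mul, this, Complex.norm_exp_ofReal_mul_I, one_mul]

/-- The operator `e^{-iaΔ}` on `L²(𝕋)`, the Fourier multiplier with symbol `e^{ik²a}`. -/
def propagator (a : ℝ) (f : L2x) : L2x :=
  fourierBasis.repr.symm
    ⟨fun k : ℤ => Complex.exp (Complex.I * (k : ℂ) ^ 2 * a) * fourierBasis.repr f k,
      memℓp_phase_mul a (fourierBasis.repr f)⟩

theorem fourierCoeff_propagator (a : ℝ) (f : L2x) (k : ℤ) :
    fourierCoeff (propagator a f) k =
      Complex.exp (Complex.I * (k : ℂ) ^ 2 * a) * fourierCoeff f k := by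
  rw [← fourierBasis_repr, ← fourierBasis_repr, propagator, LinearIsometryEquiv.apply_symm_apply]

/-- Lebesgue measure on the time interval `(0, T)`, as a measure on the time axis `[0, ∞)`. -/
def timeMeasure (T : ℝ≥0) : Measure ℝ≥0 :=
  ((volume : Measure ℝ).restrict (Ioo (0 : ℝ) T)).map Real.toNNReal

/-! ### Sobolev spaces of Hilbert space valued functions of time -/

section Sobolev

variable {H : Type*} [NormedAddCommGroup H] [InnerProductSpace ℂ H] [CompleteSpace H]

open scoped FourierTransform in
/-- The norm `‖⟨D⟩ᵇ g‖_{L²(ℝ; H)}` of `Hᵇ(ℝ; H)`, with values in `[0, ∞]`. The Fourier transform is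
normalized as `∫ e^{-2πitτ} g(t) dt`, so that `D = -i d/dt` has the symbol `2πτ`. -/
def lineSobolevNorm (b : ℝ) (g : Lp H 2 (volume : Measure ℝ)) : ℝ≥0∞ :=
  (∫⁻ τ : ℝ, ENNReal.ofReal ((1 + (2 * Real.pi * τ) ^ 2) ^ b) * ‖(𝓕 g) τ‖ₑ ^ 2) ^ (1 / 2 : ℝ)

/-- The norm of `Hᵇ(0, T; H)` (for `b ≥ 0`), with values in `[0, ∞]`: the infimum of the norms in
`Hᵇ(ℝ; H)` of the extensions of `f` from `(0, T)` to `ℝ`. It is `∞` if there is no extension in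
`Hᵇ(ℝ; H)`, and it depends only on the values of `f` at almost every `t ∈ (0, T)`. -/
def sobolevNorm (b : ℝ) (T : ℝ≥0) (f : ℝ≥0 → H) : ℝ≥0∞ :=
  ⨅ (g : Lp H 2 (volume : Measure ℝ))
    (_ : ∀ᵐ t : ℝ≥0 ∂(timeMeasure T), g (t : ℝ) = f t),
    lineSobolevNorm b g

end Sobolev

/-! ### Processes -/

section Processes

variable {Ω : Type*} {m : MeasurableSpace Ω}

/-- `W` is a standard real Brownian motion with respect to the filtration `ℱ`. -/
structure IsBrownianMotion (ℱ : Filtration ℝ≥0 m) (W : ℝ≥0 → Ω → ℝ) (P : Measure Ω) : Prop where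
  isBrownianReal : IsBrownianReal W P
  adapted : Adapted ℱ W
  indep_increment : ∀ s t : ℝ≥0, s ≤ t →
    Indep (MeasurableSpace.comap (fun ω => W t ω - W s ω) inferInstance) (ℱ s) P

/-- On the time interval `(0, T)`, the process `u` coincides for almost every `(t, ω)` with a
process that is strongly measurable for the predictable σ-algebra. -/
def IsPredictableOn {E : Type*} [TopologicalSpace E] (ℱ : Filtration ℝ≥0 m) (P : Measure Ω)
    (T : ℝ≥0) (u : ℝ≥0 → Ω → E) : Prop :=
  AEStronglyMeasurable[ℱ.predictable] (Function.uncurry u)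
    ((timeMeasure T).prod P)

/-- The process `ψ(t) = e^{iW_tΔ} u(t)`, so that `u(t) = e^{-iW_tΔ} ψ(t)`. -/
def untwist (W : ℝ≥0 → Ω → ℝ) (u : ℝ≥0 → Ω → L2x) : ℝ≥0 → Ω → L2x :=
  fun t ω => propagator (-W t ω) (u t ω)

/-- The norm `‖e^{-iW_tΔ} ψ‖ = ‖ψ‖_{L⁴_ω Hᵇ_t(0, T; L²_x)}` of the stochastic Fourier restriction
space `X^{0,b}_4(T)`, with values in `[0, ∞]`. -/
def xNorm (W : ℝ≥0 → Ω → ℝ) (P : Measure Ω) (b : ℝ) (T : ℝ≥0) (u : ℝ≥0 → Ω → L2x) : ℝ≥0∞ :=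
  (∫⁻ ω, sobolevNorm b T (fun t => untwist W u t ω) ^ 4 ∂P) ^ (1 / 4 : ℝ)

/-- Membership in the stochastic Fourier restriction space `X^{0,b}_4(T)`. -/
structure MemX (ℱ : Filtration ℝ≥0 m) (W : ℝ≥0 → Ω → ℝ) (P : Measure Ω) (b : ℝ) (T : ℝ≥0)
    (u : ℝ≥0 → Ω → L2x) : Prop where
  predictable : IsPredictableOn ℱ P T (untwist W u)
  norm_lt_top : xNorm W P b T u < ∞

/-- The norm of `L⁴_ω L⁴_T L⁴_x`, with values in `[0, ∞]`. -/
def l4Norm (P : Measure Ω) (T : ℝ≥0) (u : ℝ≥0 → Ω → L2x) : ℝ≥0∞ :=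
  (∫⁻ ω, ∫⁻ t, eLpNorm (u t ω) 4 torusMeasure ^ 4 ∂(timeMeasure T) ∂P) ^ (1 / 4 : ℝ)

/-- Membership in `L⁴_ω L⁴_T L⁴_x`: `u` is, up to almost everywhere equality, a predictable process
with values in `L⁴(𝕋)`, and its norm is finite. -/
structure MemL4 (ℱ : Filtration ℝ≥0 m) (P : Measure Ω) (T : ℝ≥0) (u : ℝ≥0 → Ω → L2x) :
    Prop where
  predictable : ∃ v : ℝ≥0 → Ω → L4x, IsPredictableOn ℱ P T v ∧
    ∀ᵐ p ∂((timeMeasure T).prod P),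
      (v p.1 p.2 : Torus → ℂ) =ᵐ[torusMeasure] (u p.1 p.2 : Torus → ℂ)
  norm_lt_top : l4Norm P T u < ∞

end Processes

end StochasticFourierRestriction

end

/-! Write `u(t) = e^{-iW_tΔ}ψ(t)` and approximate `ψ` at scale `δ = 2⁻ⁿ` by a causal step function:
on each cell of length `δ` it takes the average of `ψ` over the previous cell. Its value is then
known at the start of the cell, so the later Brownian increment is independent of it. The
approximations converge to `ψ` almost everywhere, and the increments between consecutive scales are
summed in `L⁴`.

Dispersion: for `X` Gaussian of variance `v ≤ 1`, expanding `‖e^{-iXΔ}f‖₄⁴` in Fourier series and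
averaging leaves the frequencies with `k₁ - k₂ + k₃ - k₄ = 0`, weighted by `exp(-v R² / 2)`, where
`R = -2(k₁ - k₂)(k₃ - k₂)`. The weight is at most `exp(-2v(k₁ - k₂)⁴) + exp(-2v(k₃ - k₂)⁴)`, and `∑
exp(-2vm⁴) ≲ v^{-1/4}`, so the average is `≲ v^{-1/4}‖f‖₂⁴`
(`lintegral_gaussian_eLpNorm_propagator_le_rpow`). With `v` the time since the start of a cell,
integration gives `δ^{3/4}` times the fourth moment of the value on the cell
(`IsBrownianMotion.setLIntegral_cell_le`).

Regularity: an `Hᵇ` function is `b`-Hölder in `L²`, so the values `c_k` of an increment satisfy `∑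
‖c_k‖² ≲ δ^{2b-1}‖ψ‖²_{Hᵇ}` (`tsum_enorm_stepIncr_sq_le`). The first cell has no predecessor and
needs a bound `∫_0^δ ‖ψ‖² ≲ δ^{2b}‖ψ‖²`, available for `b < 1/2`; it suffices to treat `b ≤ 3/8`.

Since `∑ ‖c_k‖⁴ ≤ (∑ ‖c_k‖²)²`, scale `n` contributes `δ^{3/4} δ^{4b-2} = δ^{4(b - 5/16)}` to the
fourth power of the norm. This is geometric exactly when `b > 5/16`. No step sees `T`, because cells
sticking out of `(0, T)` only enlarge the bound. -/

open MeasureTheory ProbabilityTheory Set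
open scoped NNReal ENNReal

noncomputable section

namespace StochasticFourierRestriction

set_option linter.unusedSectionVars false

/-! ### Translations and `L²` Hölder continuity of `Hᵇ` functions -/

section Translation

open scoped FourierTransform SchwartzMap

variable {H : Type*} [NormedAddCommGroup H] [InnerProductSpace ℂ H] [CompleteSpace H]

theorem memLp_fourierChar_smul (h : ℝ) (f : Lp H 2 (volume : Measure ℝ)) :
    MemLp (fun τ : ℝ => Real.fourierChar (-(h * τ)) • f τ) 2 volume := by
  refine (Lp.memLp f).congr_norm ?_ (.of_forall fun τ => by simp [Circle.norm_smul])
  have hc : Continuous fun τ : ℝ => Real.fourierChar (-(h * τ)) := by fun_prop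
  exact hc.aestronglyMeasurable.smul (Lp.aestronglyMeasurable f)

/-- Multiplication by the character `e^{-2πihτ}` on `L²(ℝ; H)`. -/
def modulation (h : ℝ) (f : Lp H 2 (volume : Measure ℝ)) : Lp H 2 (volume : Measure ℝ) :=
  (memLp_fourierChar_smul h f).toLp _

theorem modulation_ae (h : ℝ) (f : Lp H 2 (volume : Measure ℝ)) :
    modulation h f =ᵐ[volume] fun τ : ℝ => Real.fourierChar (-(h * τ)) • f τ :=
  MemLp.coeFn_toLp _

theorem isometry_modulation (h : ℝ) :
    Isometry (modulation h : Lp H 2 (volume : Measure ℝ) → Lp H 2 (volume : Measure ℝ)) := by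
  intro f g
  rw [modulation, modulation, Lp.edist_toLp_toLp, Lp.edist_def]
  refine eLpNorm_congr_norm_ae (.of_forall fun τ => ?_)
  simp only [Pi.sub_apply, ← smul_sub, Circle.norm_smul]

theorem measurePreserving_sub (h : ℝ) :
    MeasurePreserving (fun t : ℝ => t - h) volume volume :=
  measurePreserving_sub_right volume h

/-- Translation by `h` on `L²(ℝ; H)`. -/
def translation (h : ℝ) (f : Lp H 2 (volume : Measure ℝ)) : Lp H 2 (volume : Measure ℝ) :=
  Lp.compMeasurePreserving (fun t : ℝ => t - h) (measurePreserving_sub h) f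

theorem translation_ae (h : ℝ) (f : Lp H 2 (volume : Measure ℝ)) :
    translation h f =ᵐ[volume] fun t => f (t - h) :=
  Lp.coeFn_compMeasurePreserving _ _

/-- Both sides are continuous in `f`, and on the dense Schwartz functions the identity is a change
of variables in the Fourier integral. -/
theorem fourier_translation (h : ℝ) (f : Lp H 2 (volume : Measure ℝ)) :
    𝓕 (translation h f) = modulation h (𝓕 f) := by
  refine DenseRange.induction_on (p := fun f => 𝓕 (translation h f) = modulation h (𝓕 f))
    (SchwartzMap.denseRange_toLpCLM (E := ℝ) (F := H) (p := 2) (μ := volume)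
      ENNReal.ofNat_ne_top) f ?_ fun φ => ?_
  · have h1 := (Lp.fourierTransformₗᵢ ℝ H).continuous
    exact isClosed_eq (h1.comp (Lp.isometry_compMeasurePreserving _).continuous)
      ((isometry_modulation h).continuous.comp h1)
  · have h1 : translation h (φ.toLp 2) = (φ.compSubConstCLM ℂ h).toLp 2 := by
      apply Lp.ext
      refine (translation_ae h _).trans ?_
      filter_upwards [(φ.compSubConstCLM ℂ h).coeFn_toLp 2 volume,
        (measurePreserving_sub h).quasiMeasurePreserving.ae (φ.coeFn_toLp 2 volume)] with t h1 h2
      rw [h1, h2, SchwartzMap.compSubConstCLM_apply]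
    change 𝓕 (translation h (φ.toLp 2)) = modulation h (𝓕 (φ.toLp 2))
    rw [h1, SchwartzMap.toLp_fourier_eq, SchwartzMap.toLp_fourier_eq]
    apply Lp.ext
    refine Filter.EventuallyEq.trans ?_ (modulation_ae h _).symm
    filter_upwards [(𝓕 (φ.compSubConstCLM ℂ h)).coeFn_toLp 2 volume,
      (𝓕 φ).coeFn_toLp 2 volume] with τ h1 h2
    rw [h1, h2, SchwartzMap.fourier_coe, SchwartzMap.fourier_coe]
    have := congrFun (VectorFourier.fourierIntegral_comp_add_right Real.fourierChar
      (volume : Measure ℝ) (innerₗ ℝ) φ (-h)) τ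
    simp only [innerₗ_apply_apply] at this
    have e : -(h * τ) = inner ℝ (-h) τ := by simp [mul_comm]
    rw [e]
    exact this

/-- Interpolation of the Lipschitz bound `|h| |2πτ|` and the trivial bound `2`, with weights `b` and
`1 - b`. -/
theorem norm_fourierChar_sub_one_sq_le {b : ℝ} (hb0 : 0 ≤ b) (hb1 : b ≤ 1) (h τ : ℝ) :
    ‖(Real.fourierChar (-(h * τ)) : ℂ) - 1‖ ^ 2 ≤
      4 * |h| ^ (2 * b) * (1 + (2 * Real.pi * τ) ^ 2) ^ b := by
  have e1 : ‖(Real.fourierChar (-(h * τ)) : ℂ) - 1‖ ≤ |h| * |2 * Real.pi * τ| := by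
    rw [Real.fourierChar_apply, mul_comm _ Complex.I]
    refine (Real.norm_exp_I_mul_ofReal_sub_one_le).trans (le_of_eq ?_)
    rw [Real.norm_eq_abs, ← abs_mul, ← abs_neg]; congr 1; ring
  have e2 : ‖(Real.fourierChar (-(h * τ)) : ℂ) - 1‖ ≤ 2 := by
    refine (norm_sub_le _ _).trans ?_
    rw [Circle.norm_coe, norm_one]; norm_num
  set x := ‖(Real.fourierChar (-(h * τ)) : ℂ) - 1‖ with hx
  have hx0 : 0 ≤ x := norm_nonneg _
  have e3 : x ^ 2 = (x ^ 2) ^ b * (x ^ 2) ^ (1 - b) := by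
    rcases hx0.eq_or_lt with h0 | h0
    · rw [← h0]; 
      by_cases hb : b = 0
      · subst hb; norm_num
      · norm_num [hb, Real.zero_rpow]
    · rw [← Real.rpow_add (by positivity)]; norm_num
  have e4 : (x ^ 2) ^ b ≤ |h| ^ (2 * b) * (1 + (2 * Real.pi * τ) ^ 2) ^ b := by
    rw [Real.rpow_mul (abs_nonneg h), ← Real.mul_rpow (by positivity) (by positivity)]
    refine Real.rpow_le_rpow (by positivity) ?_ hb0
    rw [Real.rpow_two]
    nlinarith [mul_self_le_mul_self hx0 e1, sq_abs (2 * Real.pi * τ), sq_nonneg (|h|)]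
  have e5 : (x ^ 2) ^ (1 - b) ≤ 4 := by
    calc (x ^ 2) ^ (1 - b) ≤ (4 : ℝ) ^ (1 - b) :=
          Real.rpow_le_rpow (by positivity) (by nlinarith) (by linarith)
      _ ≤ (4 : ℝ) ^ (1 : ℝ) := Real.rpow_le_rpow_of_exponent_le (by norm_num) (by linarith)
      _ = 4 := Real.rpow_one _
  calc x ^ 2 = (x ^ 2) ^ b * (x ^ 2) ^ (1 - b) := e3
    _ ≤ (|h| ^ (2 * b) * (1 + (2 * Real.pi * τ) ^ 2) ^ b) * 4 :=
        mul_le_mul e4 e5 (by positivity) (by positivity)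
    _ = _ := by ring

theorem enorm_sq_eq_lintegral (f : Lp H 2 (volume : Measure ℝ)) :
    ‖f‖ₑ ^ 2 = ∫⁻ t, ‖f t‖ₑ ^ 2 := by
  rw [Lp.enorm_def, eLpNorm_eq_lintegral_rpow_enorm_toReal (by norm_num) (by norm_num)]
  rw [← ENNReal.rpow_natCast, ← ENNReal.rpow_mul]
  norm_num

theorem lineSobolevNorm_sq (b : ℝ) (g : Lp H 2 (volume : Measure ℝ)) :
    lineSobolevNorm b g ^ 2 =
      ∫⁻ τ : ℝ, ENNReal.ofReal ((1 + (2 * Real.pi * τ) ^ 2) ^ b) * ‖(𝓕 g) τ‖ₑ ^ 2 := by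
  rw [lineSobolevNorm, ← ENNReal.rpow_natCast, ← ENNReal.rpow_mul]
  norm_num

/-- A function in `Hᵇ(ℝ; H)` is Hölder continuous of order `b` in `L²`. -/
theorem lintegral_enorm_translation_sub_le {b : ℝ} (hb0 : 0 ≤ b) (hb1 : b ≤ 1) (h : ℝ)
    (g : Lp H 2 (volume : Measure ℝ)) :
    ∫⁻ t, ‖g (t - h) - g t‖ₑ ^ 2 ≤
      ENNReal.ofReal (4 * |h| ^ (2 * b)) * lineSobolevNorm b g ^ 2 := by
  have e1 : ∫⁻ t, ‖g (t - h) - g t‖ₑ ^ 2 = ‖𝓕 (translation h g - g)‖ₑ ^ 2 := by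
    have : ‖𝓕 (translation h g - g)‖ₑ = ‖translation h g - g‖ₑ := by
      rw [← ofReal_norm, ← ofReal_norm, Lp.norm_fourier_eq]
    rw [this, enorm_sq_eq_lintegral]
    refine lintegral_congr_ae ?_
    filter_upwards [translation_ae h g, Lp.coeFn_sub (translation h g) g] with t h1 h2
    rw [h2, Pi.sub_apply, h1]
  have e2 : 𝓕 (translation h g - g) = modulation h (𝓕 g) - 𝓕 g := by
    rw [← fourier_translation]
    exact (Lp.fourierTransformₗᵢ ℝ H).map_sub _ _
  rw [e1, e2, enorm_sq_eq_lintegral, lineSobolevNorm_sq,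
    ← lintegral_const_mul' _ _ ENNReal.ofReal_ne_top]
  refine lintegral_mono_ae ?_
  filter_upwards [modulation_ae h (𝓕 g), Lp.coeFn_sub (modulation h (𝓕 g)) (𝓕 g)] with τ h1 h2
  rw [h2, Pi.sub_apply, h1, ← mul_assoc, ← ENNReal.ofReal_mul (by positivity)]
  have : Real.fourierChar (-(h * τ)) • (𝓕 g) τ - (𝓕 g) τ =
      ((Real.fourierChar (-(h * τ)) : ℂ) - 1) • (𝓕 g) τ := by
    rw [sub_smul, one_smul]; rfl
  rw [this, enorm_smul, mul_pow]
  gcongr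
  rw [← ofReal_norm, ← ENNReal.ofReal_pow (norm_nonneg _)]
  exact ENNReal.ofReal_le_ofReal (norm_fourierChar_sub_one_sq_le hb0 hb1 h τ)

theorem lineSobolevNorm_mono {b b' : ℝ} (hb : b ≤ b') (g : Lp H 2 (volume : Measure ℝ)) :
    lineSobolevNorm b g ≤ lineSobolevNorm b' g := by
  refine ENNReal.rpow_le_rpow (lintegral_mono fun τ => ?_) (by norm_num)
  gcongr
  nlinarith [sq_nonneg (2 * Real.pi * τ)]

theorem sobolevNorm_mono {b b' : ℝ} (hb : b ≤ b') (T : ℝ≥0) (f : ℝ≥0 → H) :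
    sobolevNorm b T f ≤ sobolevNorm b' T f :=
  iInf₂_mono fun g _ => lineSobolevNorm_mono hb g

theorem lintegral_enorm_sq_le_lineSobolevNorm {b : ℝ} (hb : 0 ≤ b)
    (g : Lp H 2 (volume : Measure ℝ)) : ∫⁻ t, ‖g t‖ₑ ^ 2 ≤ lineSobolevNorm b g ^ 2 := by
  have e : ‖𝓕 g‖ₑ = ‖g‖ₑ := by rw [← ofReal_norm, ← ofReal_norm, Lp.norm_fourier_eq]
  rw [← enorm_sq_eq_lintegral, ← e, enorm_sq_eq_lintegral, lineSobolevNorm_sq]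
  refine lintegral_mono fun τ => le_mul_of_one_le_left' ?_
  rw [← ENNReal.ofReal_one]
  exact ENNReal.ofReal_le_ofReal (Real.one_le_rpow (by nlinarith [sq_nonneg (2 * Real.pi * τ)]) hb)

end Translation

/-! ### Averages over dyadic time cells and increments between scales -/

section Cells

variable {H : Type*} [NormedAddCommGroup H] [InnerProductSpace ℂ H] [CompleteSpace H]

/-- The time cell `(iδ, (i + 1)δ]`. -/
def cell (δ : ℝ) (i : ℕ) : Set ℝ := Ioc (i * δ) ((i + 1 : ℕ) * δ)

theorem measurableSet_cell (δ : ℝ) (i : ℕ) : MeasurableSet (cell δ i) := measurableSet_Ioc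

theorem volume_cell (δ : ℝ) (i : ℕ) : volume (cell δ i) = ENNReal.ofReal δ := by
  rw [cell, Real.volume_Ioc]; push_cast; ring_nf

theorem pairwise_disjoint_cell {δ : ℝ} (hδ : 0 ≤ δ) :
    Pairwise (Function.onFun Disjoint (cell δ)) := by
  have : Monotone fun i : ℕ => (i : ℝ) * δ := fun i j hij => by dsimp only; gcongr
  exact this.pairwise_disjoint_on_Ioc_succ

/-- The average of `f` over the time cell `(iδ, (i + 1)δ]`. -/
def cellAvg (δ : ℝ) (f : ℝ → H) (i : ℕ) : H := δ⁻¹ • ∫ t in cell δ i, f t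

theorem lintegral_sq_le_measure_mul {α : Type*} {_ : MeasurableSpace α} (μ : Measure α)
    {F : α → ℝ≥0∞} (hF : AEMeasurable F μ) :
    (∫⁻ a, F a ∂μ) ^ 2 ≤ μ univ * ∫⁻ a, F a ^ 2 ∂μ := by
  have h := ENNReal.lintegral_mul_le_Lp_mul_Lq μ Real.HolderConjugate.two_two
    (f := fun _ => 1) (g := F) aemeasurable_const hF
  simp only [Pi.mul_apply, one_mul, ENNReal.one_rpow, lintegral_one] at h
  calc (∫⁻ a, F a ∂μ) ^ 2
      ≤ (μ univ ^ (1 / 2 : ℝ) * (∫⁻ a, F a ^ (2 : ℝ) ∂μ) ^ (1 / 2 : ℝ)) ^ 2 := by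
        gcongr
    _ = _ := by
      rw [mul_pow, ← ENNReal.rpow_natCast, ← ENNReal.rpow_natCast, ← ENNReal.rpow_mul,
        ← ENNReal.rpow_mul]
      norm_num

theorem ofReal_mul_enorm_inv_smul_integral_sq_le {δ : ℝ} (hδ : 0 < δ) (i : ℕ) {f : ℝ → H}
    (hf : AEStronglyMeasurable f volume) :
    ENNReal.ofReal δ * ‖δ⁻¹ • ∫ t in cell δ i, f t‖ₑ ^ 2 ≤ ∫⁻ t in cell δ i, ‖f t‖ₑ ^ 2 := by
  have hδ' : ENNReal.ofReal δ ≠ 0 := by simpa using hδ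
  have h1 : ‖∫ t in cell δ i, f t‖ₑ ^ 2 ≤
      ENNReal.ofReal δ * ∫⁻ t in cell δ i, ‖f t‖ₑ ^ 2 := by
    calc ‖∫ t in cell δ i, f t‖ₑ ^ 2 ≤ (∫⁻ t in cell δ i, ‖f t‖ₑ) ^ 2 := by
          gcongr; exact enorm_integral_le_lintegral_enorm _
      _ ≤ _ := by
          have := lintegral_sq_le_measure_mul (volume.restrict (cell δ i))
            (F := fun t => ‖f t‖ₑ) hf.enorm.restrict
          simpa [volume_cell] using this
  have h2 : ‖δ⁻¹‖ₑ = (ENNReal.ofReal δ)⁻¹ := by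
    rw [Real.enorm_eq_ofReal (by positivity), ENNReal.ofReal_inv_of_pos hδ]
  rw [enorm_smul, h2, mul_pow]
  calc ENNReal.ofReal δ * ((ENNReal.ofReal δ)⁻¹ ^ 2 * ‖∫ t in cell δ i, f t‖ₑ ^ 2)
      ≤ ENNReal.ofReal δ * ((ENNReal.ofReal δ)⁻¹ ^ 2 *
          (ENNReal.ofReal δ * ∫⁻ t in cell δ i, ‖f t‖ₑ ^ 2)) := by gcongr
    _ = (ENNReal.ofReal δ * (ENNReal.ofReal δ)⁻¹) ^ 2 * ∫⁻ t in cell δ i, ‖f t‖ₑ ^ 2 := by ring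
    _ = _ := by rw [ENNReal.mul_inv_cancel hδ' ENNReal.ofReal_ne_top]; simp

theorem ofReal_mul_enorm_cellAvg_sq_le {δ : ℝ} (hδ : 0 < δ) (i : ℕ) {f : ℝ → H}
    (hf : AEStronglyMeasurable f volume) :
    ENNReal.ofReal δ * ‖cellAvg δ f i‖ₑ ^ 2 ≤ ∫⁻ t in cell δ i, ‖f t‖ₑ ^ 2 :=
  ofReal_mul_enorm_inv_smul_integral_sq_le hδ i hf

theorem tsum_setLIntegral_cell_le {δ : ℝ} (hδ : 0 < δ) (F : ℝ → ℝ≥0∞) (n : ℕ) :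
    ∑' i : ℕ, ∫⁻ t in cell δ (i + n), F t ≤ ∫⁻ t, F t := by
  rw [← lintegral_iUnion (fun i => measurableSet_cell δ (i + n))]
  · exact setLIntegral_le_lintegral _ _
  · exact fun i j hij => pairwise_disjoint_cell hδ.le (by simpa using hij)

theorem integrableOn_cell (g : Lp H 2 (volume : Measure ℝ)) (δ : ℝ) (i : ℕ) :
    IntegrableOn g (cell δ i) :=
  ((Lp.memLp g).locallyIntegrable (by norm_num)).integrableOn_isCompact
    (isCompact_Icc (a := i * δ) (b := (i + 1 : ℕ) * δ)) |>.mono_set Ioc_subset_Icc_self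

theorem preimage_sub_cell (δ : ℝ) (i n : ℕ) :
    (fun t : ℝ => t - n * δ) ⁻¹' (cell δ i) = cell δ (i + n) := by
  ext t
  simp only [cell, mem_preimage, mem_Ioc]
  push_cast
  constructor <;> rintro ⟨h1, h2⟩ <;> constructor <;> linarith

theorem setIntegral_cell_eq (δ : ℝ) (i n : ℕ) (f : ℝ → H) :
    ∫ t in cell δ i, f t = ∫ t in cell δ (i + n), f (t - n * δ) := by
  rw [← preimage_sub_cell]
  exact ((measurePreserving_sub (n * δ)).setIntegral_preimage_emb
    (MeasurableEquiv.subRight (n * δ : ℝ)).measurableEmbedding f _).symm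

theorem setLIntegral_cell_eq (δ : ℝ) (i n : ℕ) (f : ℝ → ℝ≥0∞) :
    ∫⁻ t in cell δ i, f t = ∫⁻ t in cell δ (i + n), f (t - n * δ) := by
  rw [← preimage_sub_cell]
  exact ((measurePreserving_sub (n * δ)).setLIntegral_comp_preimage_emb
    (MeasurableEquiv.subRight (n * δ : ℝ)).measurableEmbedding f _).symm

theorem aestronglyMeasurable_comp_sub (g : Lp H 2 (volume : Measure ℝ)) (h : ℝ) :
    AEStronglyMeasurable (fun t => g (t - h)) volume :=
  ((Lp.stronglyMeasurable g).comp_measurable (measurable_id.sub_const h)).aestronglyMeasurable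

/-- After a shift by `nδ` the difference of the two averages is a single average of `g(t - nδ) -
g(t)`, to which Cauchy–Schwarz applies. Summed over `i`, this is controlled by the Hölder bound. -/
theorem ofReal_mul_enorm_cellAvg_sub_sq_le {δ : ℝ} (hδ : 0 < δ) (i n : ℕ)
    (g : Lp H 2 (volume : Measure ℝ)) :
    ENNReal.ofReal δ * ‖cellAvg δ g (i + n) - cellAvg δ g i‖ₑ ^ 2 ≤
      ∫⁻ t in cell δ (i + n), ‖g (t - n * δ) - g t‖ₑ ^ 2 := by
  have hintg : IntegrableOn (fun t => g (t - n * δ)) (cell δ (i + n)) := by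
    rw [← preimage_sub_cell]
    exact ((measurePreserving_sub (n * δ)).integrableOn_comp_preimage
      (MeasurableEquiv.subRight (n * δ : ℝ)).measurableEmbedding).2 (integrableOn_cell g δ i)
  have e : cellAvg δ g i - cellAvg δ g (i + n) =
      δ⁻¹ • ∫ t in cell δ (i + n), (g (t - n * δ) - g t) := by
    rw [integral_sub hintg (integrableOn_cell g δ _), smul_sub, ← setIntegral_cell_eq]; rfl
  rw [enorm_sub_rev, e]
  exact ofReal_mul_enorm_inv_smul_integral_sq_le hδ _
    ((aestronglyMeasurable_comp_sub g _).sub (Lp.aestronglyMeasurable g))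

theorem tsum_enorm_cellAvg_sub_sq_le {b : ℝ} (hb0 : 0 ≤ b) (hb1 : b ≤ 1) {δ : ℝ} (hδ : 0 < δ)
    (n : ℕ) (g : Lp H 2 (volume : Measure ℝ)) :
    ∑' i : ℕ, ENNReal.ofReal δ * ‖cellAvg δ g (i + n) - cellAvg δ g i‖ₑ ^ 2 ≤
      ENNReal.ofReal (4 * (n * δ) ^ (2 * b)) * lineSobolevNorm b g ^ 2 := by
  refine (ENNReal.tsum_le_tsum fun i => ofReal_mul_enorm_cellAvg_sub_sq_le hδ i n g).trans ?_
  refine (tsum_setLIntegral_cell_le hδ _ n).trans ?_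
  have := lintegral_enorm_translation_sub_le hb0 hb1 (n * δ) g
  rwa [abs_of_nonneg (by positivity)] at this

/-- Young's inequality `2‖y‖‖y - x‖ ≤ ‖y‖²/4 + 4‖y - x‖²`. The coefficient of `‖y‖²` has to be close
to `1` for the induction on the first cell to close up to `b = 3/8`. -/
theorem enorm_sq_le_five_quarters {E : Type*} [SeminormedAddCommGroup E] (x y : E) :
    4 * ‖x‖ₑ ^ 2 ≤ 5 * ‖y‖ₑ ^ 2 + 20 * ‖y - x‖ₑ ^ 2 := by
  have h : 4 * ‖x‖₊ ^ 2 ≤ 5 * ‖y‖₊ ^ 2 + 20 * ‖y - x‖₊ ^ 2 := by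
    have h1 : ‖x‖ ≤ ‖y‖ + ‖y - x‖ := by
      have := norm_sub_le y (y - x); simpa using this
    rw [← NNReal.coe_le_coe]
    push_cast
    nlinarith [norm_nonneg x, norm_nonneg y, norm_nonneg (y - x), sq_nonneg (‖y‖ - 4 * ‖y - x‖)]
  simp only [enorm_eq_nnnorm]
  exact_mod_cast h

/-- The contribution of the first time cell: a function in `Hᵇ(ℝ; H)`, with `b` less than `1/2`,
does not concentrate at a point. -/
theorem setLIntegral_cell_zero_le {b : ℝ} (hb0 : 0 ≤ b) (hb1 : b ≤ 3 / 8)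
    (g : Lp H 2 (volume : Measure ℝ)) (j : ℕ) :
    ∫⁻ t in cell ((1 / 2 : ℝ) ^ j) 0, ‖g t‖ₑ ^ 2 ≤
      160 * ENNReal.ofReal ((1 / 2 : ℝ) ^ (2 * b)) ^ j * lineSobolevNorm b g ^ 2 := by
  induction j with
  | zero =>
    refine (setLIntegral_le_lintegral _ _).trans
      ((lintegral_enorm_sq_le_lineSobolevNorm hb0 g).trans ?_)
    rw [pow_zero, mul_one]
    exact le_mul_of_one_le_left' (by norm_num)
  | succ j ih =>
    set N := lineSobolevNorm b g ^ 2
    set q := ENNReal.ofReal ((1 / 2 : ℝ) ^ (2 * b)) with hq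
    set δ : ℝ := (1 / 2 : ℝ) ^ (j + 1) with hδ
    have hδ0 : 0 < δ := by positivity
    have hsplit : cell ((1 / 2 : ℝ) ^ j) 0 = cell δ 0 ∪ cell δ 1 := by
      have : ((1 / 2 : ℝ) ^ j) = 2 * δ := by rw [hδ, pow_succ]; ring
      rw [this]
      simp only [cell]
      rw [Ioc_union_Ioc_eq_Ioc]
      · congr 1
        · push_cast; ring
        · push_cast; ring
      · push_cast; linarith
      · push_cast; linarith
    have h1 : ∫⁻ t in cell ((1 / 2 : ℝ) ^ j) 0, ‖g t‖ₑ ^ 2 =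
        (∫⁻ t in cell δ 0, ‖g t‖ₑ ^ 2) + ∫⁻ t in cell δ 1, ‖g t‖ₑ ^ 2 := by
      rw [hsplit]
      exact lintegral_union (measurableSet_cell _ _)
        (pairwise_disjoint_cell hδ0.le (by norm_num))
    have hE : ∫⁻ t in cell δ 1, ‖g (t - δ) - g t‖ₑ ^ 2 ≤ 4 * q ^ (j + 1) * N := by
      refine (setLIntegral_le_lintegral _ _).trans
        ((lintegral_enorm_translation_sub_le hb0 (by linarith) δ g).trans ?_)
      rw [abs_of_pos hδ0, ENNReal.ofReal_mul (by norm_num), hq, ← ENNReal.ofReal_pow (by positivity),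
        hδ, ← Real.rpow_natCast, ← Real.rpow_mul (by norm_num), ← Real.rpow_mul_natCast (by norm_num)]
      rw [mul_comm (2 * b)]
      norm_num [N]
    have h2 : 4 * (∫⁻ t in cell δ 0, ‖g t‖ₑ ^ 2) ≤
        5 * (∫⁻ t in cell δ 1, ‖g t‖ₑ ^ 2) +
          20 * ∫⁻ t in cell δ 1, ‖g (t - δ) - g t‖ₑ ^ 2 := by
      have hm := (Lp.stronglyMeasurable g).enorm
      rw [setLIntegral_cell_eq δ 0 1, ← lintegral_const_mul' _ _ (by norm_num),
        ← lintegral_const_mul' _ _ (by norm_num), ← lintegral_const_mul' _ _ (by norm_num),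
        ← lintegral_add_left (by fun_prop)]
      refine lintegral_mono fun t => ?_
      have := enorm_sq_le_five_quarters (g (t - δ)) (g t)
      rw [enorm_sub_rev] at this
      simpa using this
    -- Adding `5∫` over the first cell to both sides of `h2` makes the mass of the doubled cell
    -- appear on the right. Halving the cell thus multiplies the mass by at most `5/9`, up to the
    -- Hölder error.
    have h3 : 9 * (∫⁻ t in cell δ 0, ‖g t‖ₑ ^ 2) ≤
        5 * (160 * q ^ j * N) + 20 * (4 * q ^ (j + 1) * N) := by
      calc 9 * (∫⁻ t in cell δ 0, ‖g t‖ₑ ^ 2)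
          = 5 * (∫⁻ t in cell δ 0, ‖g t‖ₑ ^ 2) + 4 * (∫⁻ t in cell δ 0, ‖g t‖ₑ ^ 2) := by ring
        _ ≤ 5 * (∫⁻ t in cell δ 0, ‖g t‖ₑ ^ 2) + (5 * (∫⁻ t in cell δ 1, ‖g t‖ₑ ^ 2) +
            20 * ∫⁻ t in cell δ 1, ‖g (t - δ) - g t‖ₑ ^ 2) := by gcongr
        _ = 5 * (∫⁻ t in cell ((1 / 2 : ℝ) ^ j) 0, ‖g t‖ₑ ^ 2) +
            20 * ∫⁻ t in cell δ 1, ‖g (t - δ) - g t‖ₑ ^ 2 := by rw [h1]; ring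
        _ ≤ _ := by gcongr
    -- Here `b ≤ 3/8` enters: `q⁻¹ = 2^{2b} ≤ 2^{3/4} < 17/10`, which is below `9/5`.
    have hq1 : (1 : ℝ≥0∞) ≤ ENNReal.ofReal (17 / 10) * q := by
      rw [hq, ← ENNReal.ofReal_mul (by norm_num), ← ENNReal.ofReal_one]
      apply ENNReal.ofReal_le_ofReal
      have a1 : (1 / 2 : ℝ) ^ (3 / 4 : ℝ) ≤ (1 / 2 : ℝ) ^ (2 * b) :=
        Real.rpow_le_rpow_of_exponent_ge (by norm_num) (by norm_num) (by linarith)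
      have a2 : (10 / 17 : ℝ) ≤ (1 / 2 : ℝ) ^ (3 / 4 : ℝ) := by
        refine le_of_pow_le_pow_left₀ (n := 4) (by norm_num) (by positivity) ?_
        rw [← Real.rpow_mul_natCast (by norm_num)]
        norm_num
      linarith
    -- The constant `160` closes the induction with equality: `5 · 160 · 17/10 + 80 = 1440 = 9 ·
    -- 160`.
    have h4 : 5 * (160 * q ^ j * N) + 20 * (4 * q ^ (j + 1) * N) ≤
        9 * (160 * q ^ (j + 1) * N) := by
      calc 5 * (160 * q ^ j * N) + 20 * (4 * q ^ (j + 1) * N)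
          ≤ 5 * (160 * (q ^ j * (ENNReal.ofReal (17 / 10) * q)) * N) +
            20 * (4 * q ^ (j + 1) * N) := by
              gcongr
              exact le_mul_of_one_le_right' hq1
        _ = (800 * ENNReal.ofReal (17 / 10) + 80) * q ^ (j + 1) * N := by ring
        _ = 1440 * q ^ (j + 1) * N := by
              congr 2
              rw [← ENNReal.ofReal_ofNat, ← ENNReal.ofReal_ofNat, ← ENNReal.ofReal_ofNat,
                ← ENNReal.ofReal_mul (by norm_num), ← ENNReal.ofReal_add (by norm_num) (by norm_num)]
              norm_num
        _ = _ := by ring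
    exact (ENNReal.mul_le_mul_iff_right (by norm_num) (by norm_num)).1 (h3.trans h4)

/-- The value on the cell `(k2⁻ʲ, (k + 1)2⁻ʲ]` of the causal step function approximation of `f`:
the average of `f` over the previous cell. -/
def stepCoeff (f : ℝ → H) (j k : ℕ) : H :=
  if k = 0 then 0 else cellAvg ((1 / 2 : ℝ) ^ j) f (k - 1)

/-- The increment of the causal step function approximations of `f` from the scale `2⁻ʲ` to the
scale `2⁻⁽ʲ⁺¹⁾`, on the cell `(k2⁻⁽ʲ⁺¹⁾, (k + 1)2⁻⁽ʲ⁺¹⁾]`. -/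
def stepDiff (f : ℝ → H) (j k : ℕ) : H := stepCoeff f (j + 1) k - stepCoeff f j (k / 2)

theorem cellAvg_eq_half_add (g : Lp H 2 (volume : Measure ℝ)) (j i : ℕ) :
    cellAvg ((1 / 2 : ℝ) ^ j) g i =
      (1 / 2 : ℝ) • (cellAvg ((1 / 2 : ℝ) ^ (j + 1)) g (2 * i) +
        cellAvg ((1 / 2 : ℝ) ^ (j + 1)) g (2 * i + 1)) := by
  set δ : ℝ := (1 / 2 : ℝ) ^ (j + 1) with hδ
  have hδ0 : 0 < δ := by positivity
  have h2 : ((1 / 2 : ℝ) ^ j) = 2 * δ := by rw [hδ, pow_succ]; ring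
  have hsplit : cell ((1 / 2 : ℝ) ^ j) i = cell δ (2 * i) ∪ cell δ (2 * i + 1) := by
    rw [h2]
    simp only [cell]
    rw [Ioc_union_Ioc_eq_Ioc]
    · congr 1 <;> push_cast <;> ring
    · push_cast; linarith
    · push_cast; linarith
  rw [cellAvg, hsplit, setIntegral_union (pairwise_disjoint_cell hδ0.le (by simp))
    (measurableSet_cell _ _) (integrableOn_cell g _ _) (integrableOn_cell g _ _), h2, cellAvg,
    cellAvg, ← smul_add, smul_smul]
  congr 1
  field_simp

/-- The coarse average is the mean of the fine averages `2p` and `2p + 1`, so away from the origin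
an increment only involves differences of fine averages at distance one or two. -/
theorem stepDiff_even (g : Lp H 2 (volume : Measure ℝ)) (j p : ℕ) :
    stepDiff g j (2 * p + 2) = (1 / 2 : ℝ) • (cellAvg ((1 / 2 : ℝ) ^ (j + 1)) g (2 * p + 1) -
      cellAvg ((1 / 2 : ℝ) ^ (j + 1)) g (2 * p)) := by
  have : (2 * p + 2) / 2 = p + 1 := by omega
  simp only [stepDiff, stepCoeff, this]
  simp only [Nat.add_eq_zero_iff, OfNat.ofNat_ne_zero, one_ne_zero, and_false, if_false]
  rw [show 2 * p + 2 - 1 = 2 * p + 1 by omega, Nat.add_sub_cancel, cellAvg_eq_half_add g j p]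
  module

theorem stepDiff_odd (g : Lp H 2 (volume : Measure ℝ)) (j p : ℕ) :
    stepDiff g j (2 * p + 3) =
      (1 / 2 : ℝ) • (cellAvg ((1 / 2 : ℝ) ^ (j + 1)) g (2 * p + 2) -
        cellAvg ((1 / 2 : ℝ) ^ (j + 1)) g (2 * p + 1)) +
      (1 / 2 : ℝ) • (cellAvg ((1 / 2 : ℝ) ^ (j + 1)) g (2 * p + 2) -
        cellAvg ((1 / 2 : ℝ) ^ (j + 1)) g (2 * p)) := by
  have : (2 * p + 3) / 2 = p + 1 := by omega
  simp only [stepDiff, stepCoeff, this]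
  simp only [Nat.add_eq_zero_iff, OfNat.ofNat_ne_zero, one_ne_zero, and_false, if_false]
  rw [show 2 * p + 3 - 1 = 2 * p + 2 by omega, Nat.add_sub_cancel, cellAvg_eq_half_add g j p]
  module

theorem enorm_half_smul_add_sq_le {E : Type*} [NormedAddCommGroup E] [NormedSpace ℝ E] (x y : E) :
    ‖(1 / 2 : ℝ) • x + (1 / 2 : ℝ) • y‖ₑ ^ 2 ≤ ‖x‖ₑ ^ 2 + ‖y‖ₑ ^ 2 := by
  have h : ‖(1 / 2 : ℝ) • x + (1 / 2 : ℝ) • y‖₊ ^ 2 ≤ ‖x‖₊ ^ 2 + ‖y‖₊ ^ 2 := by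
    rw [← NNReal.coe_le_coe]
    push_cast
    have h1 := norm_add_le ((1 / 2 : ℝ) • x) ((1 / 2 : ℝ) • y)
    rw [norm_smul, norm_smul] at h1
    norm_num at h1
    have h0 := norm_nonneg ((1 / 2 : ℝ) • x + (1 / 2 : ℝ) • y)
    have h2 := pow_le_pow_left₀ h0 h1 2
    nlinarith [norm_nonneg x, norm_nonneg y, sq_nonneg (‖x‖ - ‖y‖)]
  simp only [enorm_eq_nnnorm]
  exact_mod_cast h

theorem tsum_enorm_stepDiff_sq_le_tsum (g : Lp H 2 (volume : Measure ℝ)) (j : ℕ) :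
    ∑' k, ‖stepDiff g j k‖ₑ ^ 2 ≤
      ‖cellAvg ((1 / 2 : ℝ) ^ (j + 1)) g 0‖ₑ ^ 2 +
      ∑' i, ‖cellAvg ((1 / 2 : ℝ) ^ (j + 1)) g (i + 1) -
        cellAvg ((1 / 2 : ℝ) ^ (j + 1)) g i‖ₑ ^ 2 +
      ∑' i, ‖cellAvg ((1 / 2 : ℝ) ^ (j + 1)) g (i + 2) -
        cellAvg ((1 / 2 : ℝ) ^ (j + 1)) g i‖ₑ ^ 2 := by
  set A := cellAvg ((1 / 2 : ℝ) ^ (j + 1)) g with hA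
  have d0 : stepDiff g j 0 = 0 := by simp [stepDiff, stepCoeff]
  -- The coarse step function vanishes on its first cell, which contains the fine cell `1`. This is
  -- the only increment that is not a difference of averages.
  have d1 : stepDiff g j 1 = A 0 := by simp [stepDiff, stepCoeff, hA]
  have d2 : ‖stepDiff g j 2‖ₑ ^ 2 ≤ ‖A 1 - A 0‖ₑ ^ 2 := by
    have h1 := stepDiff_even g j 0
    have h2 := enorm_half_smul_add_sq_le (A 1 - A 0) 0
    simp only [mul_zero, zero_add, smul_zero, add_zero, enorm_zero] at h1 h2
    rw [h1, ← hA]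
    exact h2.trans (by simp)
  have d3 : ∀ n, ‖stepDiff g j (n + 3)‖ₑ ^ 2 ≤
      ‖A (n + 1 + 1) - A (n + 1)‖ₑ ^ 2 + ‖A (n + 2) - A n‖ₑ ^ 2 := by
    intro n
    rcases Nat.even_or_odd' n with ⟨p, rfl | rfl⟩
    · rw [stepDiff_odd]
      exact enorm_half_smul_add_sq_le _ _
    · rw [show 2 * p + 1 + 3 = 2 * (p + 1) + 2 by ring, stepDiff_even]
      have h2 := enorm_half_smul_add_sq_le (A (2 * (p + 1) + 1) - A (2 * (p + 1))) 0
      simp only [smul_zero, add_zero, enorm_zero] at h2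
      refine (h2.trans (le_of_eq ?_)).trans le_self_add
      simp only [ne_eq, OfNat.ofNat_ne_zero, not_false_eq_true, zero_pow, add_zero]
      congr 4
  rw [tsum_eq_zero_add' ENNReal.summable, tsum_eq_zero_add' ENNReal.summable,
    tsum_eq_zero_add' ENNReal.summable, d0, zero_add, d1,
    tsum_eq_zero_add' (f := fun i => ‖A (i + 1) - A i‖ₑ ^ 2) ENNReal.summable]
  simp only [zero_add, enorm_zero, ne_eq, OfNat.ofNat_ne_zero, not_false_eq_true, zero_pow,
    Nat.reduceAdd]
  calc ‖A 0‖ₑ ^ 2 + (‖stepDiff g j 2‖ₑ ^ 2 + ∑' n, ‖stepDiff g j (n + 1 + 1 + 1)‖ₑ ^ 2)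
      ≤ ‖A 0‖ₑ ^ 2 + (‖A 1 - A 0‖ₑ ^ 2 + ∑' n, (‖A (n + 1 + 1) - A (n + 1)‖ₑ ^ 2 +
        ‖A (n + 2) - A n‖ₑ ^ 2)) := by
        gcongr with n
        exact d3 n
    _ = _ := by rw [ENNReal.tsum_add]; ring

theorem tsum_enorm_stepDiff_sq_le {b : ℝ} (hb0 : 0 ≤ b) (hb1 : b ≤ 3 / 8)
    (g : Lp H 2 (volume : Measure ℝ)) (j : ℕ) :
    ENNReal.ofReal ((1 / 2 : ℝ) ^ (j + 1)) * ∑' k, ‖stepDiff g j k‖ₑ ^ 2 ≤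
      180 * ENNReal.ofReal ((1 / 2 : ℝ) ^ (2 * b)) ^ (j + 1) * lineSobolevNorm b g ^ 2 := by
  set δ : ℝ := (1 / 2 : ℝ) ^ (j + 1) with hδ
  have hδ0 : 0 < δ := by positivity
  set N := lineSobolevNorm b g ^ 2
  set q := ENNReal.ofReal ((1 / 2 : ℝ) ^ (2 * b)) with hq
  have hqδ : ENNReal.ofReal (δ ^ (2 * b)) = q ^ (j + 1) := by
    rw [hq, ← ENNReal.ofReal_pow (by positivity),
        hδ, ← Real.rpow_natCast, ← Real.rpow_mul (by norm_num), ← Real.rpow_mul_natCast (by norm_num)]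
    rw [mul_comm (2 * b)]
  have e0 := (ofReal_mul_enorm_cellAvg_sq_le hδ0 0 (Lp.aestronglyMeasurable g)).trans
    (setLIntegral_cell_zero_le hb0 hb1 g (j + 1))
  have e1 := tsum_enorm_cellAvg_sub_sq_le hb0 (by linarith) hδ0 1 g
  have e2 := tsum_enorm_cellAvg_sub_sq_le hb0 (by linarith) hδ0 2 g
  rw [ENNReal.tsum_mul_left] at e1 e2
  have f1 : ENNReal.ofReal (4 * ((1 : ℕ) * δ) ^ (2 * b)) = 4 * q ^ (j + 1) := by
    rw [ENNReal.ofReal_mul (by norm_num), Nat.cast_one, one_mul, hqδ]; norm_num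
  have f2 : ENNReal.ofReal (4 * ((2 : ℕ) * δ) ^ (2 * b)) ≤ 16 * q ^ (j + 1) := by
    rw [Real.mul_rpow (by norm_num) hδ0.le, ← mul_assoc, ENNReal.ofReal_mul (by positivity), hqδ]
    gcongr
    rw [← ENNReal.ofReal_ofNat]
    apply ENNReal.ofReal_le_ofReal
    have : ((2 : ℕ) : ℝ) ^ (2 * b) ≤ 2 ^ (1 : ℝ) := by
      rw [Nat.cast_ofNat]
      exact Real.rpow_le_rpow_of_exponent_le (by norm_num) (by linarith)
    rw [Real.rpow_one] at this
    linarith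
  -- The constant `180` is `160` from the first cell plus `4` and `16` from the differences at
  -- distance one and two.
  calc ENNReal.ofReal δ * ∑' k, ‖stepDiff g j k‖ₑ ^ 2
      ≤ 160 * q ^ (j + 1) * N + 4 * q ^ (j + 1) * N + 16 * q ^ (j + 1) * N := by
        refine (mul_le_mul_right (tsum_enorm_stepDiff_sq_le_tsum g j) _).trans ?_
        rw [mul_add, mul_add]
        refine add_le_add (add_le_add e0 (e1.trans (by rw [f1]))) (e2.trans (by gcongr))
    _ = _ := by ring

theorem tsum_enorm_stepCoeff_zero_sq_le {b : ℝ} (hb0 : 0 ≤ b) (g : Lp H 2 (volume : Measure ℝ)) :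
    ∑' k, ‖stepCoeff g 0 k‖ₑ ^ 2 ≤ lineSobolevNorm b g ^ 2 := by
  rw [tsum_eq_zero_add' ENNReal.summable]
  simp only [stepCoeff, if_true, Nat.add_eq_zero_iff, one_ne_zero, and_false, if_false,
    Nat.add_sub_cancel, pow_zero, enorm_zero, ne_eq, OfNat.ofNat_ne_zero, not_false_eq_true,
    zero_pow, zero_add]
  refine le_trans (ENNReal.tsum_le_tsum fun i => ?_)
    ((tsum_setLIntegral_cell_le one_pos (fun t => ‖g t‖ₑ ^ 2) 0).trans
      (lintegral_enorm_sq_le_lineSobolevNorm hb0 g))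
  simpa using ofReal_mul_enorm_cellAvg_sq_le one_pos i (Lp.aestronglyMeasurable g)

end Cells

/-! ### The Schrödinger group and lower semicontinuity of the `L⁴` norm -/

instance : MeasurableSpace L2x := borel _
instance : BorelSpace L2x := ⟨rfl⟩

section Propagator

open Filter Topology

theorem fourierBasis_repr_propagator (a : ℝ) (f : L2x) (k : ℤ) :
    fourierBasis.repr (propagator a f) k =
      Complex.exp (Complex.I * (k : ℂ) ^ 2 * a) * fourierBasis.repr f k := by
  rw [propagator, LinearIsometryEquiv.apply_symm_apply]

theorem ext_fourierBasis_repr {f g : L2x}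
    (h : ∀ k, fourierBasis.repr f k = fourierBasis.repr g k) : f = g := by
  apply fourierBasis.repr.injective
  exact lp.ext (funext h)

theorem propagator_add (a : ℝ) (f g : L2x) :
    propagator a (f + g) = propagator a f + propagator a g := by
  refine ext_fourierBasis_repr fun k => ?_
  simp only [fourierBasis_repr_propagator, map_add, lp.coeFn_add, Pi.add_apply, mul_add]

theorem propagator_smul (a : ℝ) (c : ℂ) (f : L2x) :
    propagator a (c • f) = c • propagator a f := by
  refine ext_fourierBasis_repr fun k => ?_
  simp only [fourierBasis_repr_propagator, map_smul, lp.coeFn_smul, Pi.smul_apply, smul_eq_mul,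
    mul_left_comm]

theorem propagator_propagator (a a' : ℝ) (f : L2x) :
    propagator a (propagator a' f) = propagator (a + a') f := by
  refine ext_fourierBasis_repr fun k => ?_
  simp only [fourierBasis_repr_propagator, ← mul_assoc, ← Complex.exp_add]
  congr 2; push_cast; ring

theorem propagator_zero (f : L2x) : propagator 0 f = f := by
  refine ext_fourierBasis_repr fun k => ?_
  simp [fourierBasis_repr_propagator]

theorem norm_exp_I_mul_sq_mul (k : ℤ) (a : ℝ) :
    ‖Complex.exp (Complex.I * (k : ℂ) ^ 2 * a)‖ = 1 := by
  have : Complex.I * (k : ℂ) ^ 2 * a = (((k : ℝ) ^ 2 * a : ℝ) : ℂ) * Complex.I := by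
    push_cast; ring
  rw [this, Complex.norm_exp_ofReal_mul_I]

theorem norm_propagator (a : ℝ) (f : L2x) : ‖propagator a f‖ = ‖f‖ := by
  rw [propagator, LinearIsometryEquiv.norm_map, ← fourierBasis.repr.norm_map f,
    lp.norm_eq_tsum_rpow (by norm_num), lp.norm_eq_tsum_rpow (by norm_num)]
  simp only [norm_mul, norm_exp_I_mul_sq_mul, one_mul]

/-- The operator `e^{-iaΔ}` as a linear isometry of `L²(𝕋)`. -/
def propagatorₗᵢ (a : ℝ) : L2x →ₗᵢ[ℂ] L2x where
  toFun := propagator a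
  map_add' := propagator_add a
  map_smul' := propagator_smul a
  norm_map' := norm_propagator a

theorem propagator_sub (a : ℝ) (f g : L2x) :
    propagator a (f - g) = propagator a f - propagator a g :=
  (propagatorₗᵢ a).map_sub f g

theorem propagator_fourierBasis (a : ℝ) (k : ℤ) :
    propagator a (fourierBasis k) = Complex.exp (Complex.I * (k : ℂ) ^ 2 * a) • fourierBasis k := by
  refine ext_fourierBasis_repr fun l => ?_
  simp only [fourierBasis_repr_propagator, map_smul, lp.coeFn_smul, Pi.smul_apply, smul_eq_mul]
  by_cases h : l = k
  · rw [h]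
  · have : fourierBasis.repr (fourierBasis k : L2x) l = 0 := by
      rw [HilbertBasis.repr_self, lp.single_apply_ne _ _ _ h]
    rw [this, mul_zero, mul_zero]

/-- The Fourier partial sum of `f` with the frequencies in `S`. -/
def partialSum (S : Finset ℤ) (f : L2x) : L2x := ∑ k ∈ S, fourierBasis.repr f k • fourierBasis k

theorem tendsto_partialSum (f : L2x) : Tendsto (fun S => partialSum S f) atTop (𝓝 f) :=
  fourierBasis.hasSum_repr f

theorem propagator_partialSum (a : ℝ) (S : Finset ℤ) (f : L2x) :
    propagator a (partialSum S f) =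
      ∑ k ∈ S, (fourierBasis.repr f k * Complex.exp (Complex.I * (k : ℂ) ^ 2 * a)) •
        (fourierBasis k : L2x) := by
  change propagatorₗᵢ a (partialSum S f) = _
  rw [partialSum, map_sum]
  refine Finset.sum_congr rfl fun k _ => ?_
  rw [map_smul, mul_smul]
  congr 1
  exact propagator_fourierBasis a k

/-- The orbit of `f` is a limit of orbits of trigonometric polynomials, uniformly in `a` because the
propagators are isometries. -/
theorem continuous_propagator_left (f : L2x) : Continuous fun a => propagator a f := by
  have h : TendstoUniformly (fun S a => propagator a (partialSum S f)) (fun a => propagator a f)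
      atTop := by
    rw [Metric.tendstoUniformly_iff]
    intro ε hε
    filter_upwards [(tendsto_partialSum f).eventually (Metric.ball_mem_nhds f hε)] with S hS a
    rw [dist_eq_norm, ← propagator_sub, norm_propagator, ← dist_eq_norm, dist_comm]
    exact hS
  refine h.continuous (Frequently.of_forall fun S => ?_)
  simp only [propagator_partialSum]
  fun_prop

theorem continuous_propagator : Continuous fun p : ℝ × L2x => propagator p.1 p.2 :=
  continuous_prod_of_continuous_lipschitzWith' _ 1 (fun a => (propagatorₗᵢ a).lipschitz)
    continuous_propagator_left

/-- The `L⁴` norm is lower semicontinuous on `L²(𝕋)`. -/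
theorem lowerSemicontinuous_eLpNorm_four :
    LowerSemicontinuous fun f : L2x => eLpNorm f 4 torusMeasure := by
  rw [lowerSemicontinuous_iff_isClosed_preimage]
  intro C
  refine IsSeqClosed.isClosed fun u f hu hf => ?_
  obtain ⟨ns, -, hns⟩ := (tendstoInMeasure_of_tendsto_Lp hf).exists_seq_tendsto_ae
  refine (Lp.eLpNorm_lim_le_liminf_eLpNorm
    (fun n => Lp.aestronglyMeasurable (u (ns n))) _ hns).trans ?_
  exact (liminf_le_liminf (.of_forall fun n => hu (ns n))).trans (by simp)

theorem measurable_eLpNorm_four :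
    Measurable fun f : L2x => eLpNorm f 4 torusMeasure :=
  lowerSemicontinuous_eLpNorm_four.measurable

theorem eLpNorm_four_le_liminf {ι : Type*} {l : Filter ι} {u : ι → L2x} {f : L2x}
    (h : Tendsto u l (𝓝 f)) :
    eLpNorm f 4 torusMeasure ≤ liminf (fun i => eLpNorm (u i) 4 torusMeasure) l :=
  (lowerSemicontinuous_iff_le_liminf.1 lowerSemicontinuous_eLpNorm_four f).trans
    (liminf_le_liminf_of_le h)

end Propagator

/-! ### The Gaussian average of the `L⁴` norm -/

section Dispersion

open Filter Topology ComplexConjugate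

/-! ### Counting -/

theorem tsum_mul_shift_le (γ : ℤ → ℝ≥0∞) (a : ℤ) :
    ∑' k, γ k * γ (k + a) ≤ ∑' k, γ k ^ 2 := by
  have h1 : ∀ x y : ℝ≥0∞, x ≤ y → 2 * (x * y) ≤ x ^ 2 + y ^ 2 := fun x y hxy => by
    obtain ⟨d, rfl⟩ := exists_add_of_le hxy
    calc 2 * (x * (x + d)) ≤ 2 * (x * (x + d)) + d ^ 2 := le_self_add
      _ = _ := by ring
  have h2 : ∀ x y : ℝ≥0∞, 2 * (x * y) ≤ x ^ 2 + y ^ 2 := fun x y => by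
    rcases le_total x y with h | h
    · exact h1 x y h
    · rw [mul_comm x, add_comm]; exact h1 y x h
  have hs : ∑' k, γ (k + a) ^ 2 = ∑' k, γ k ^ 2 :=
    (Equiv.addRight a).tsum_eq fun k => γ k ^ 2
  have h : 2 * ∑' k, γ k * γ (k + a) ≤ 2 * ∑' k, γ k ^ 2 := by
    rw [← ENNReal.tsum_mul_left]
    refine (ENNReal.tsum_le_tsum fun k => h2 _ _).trans ?_
    rw [ENNReal.tsum_add, hs, two_mul]
  exact (ENNReal.mul_le_mul_iff_right (by norm_num) (by norm_num)).1 h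

/-- For fixed `a = k₁ - k₂` the sum factors into the square of the autocorrelation `∑ γ_k γ_{k+a}`,
which `tsum_mul_shift_le` bounds by `∑ γ_k²` independently of `a`. -/
theorem tsum_quartic_le (γ E : ℤ → ℝ≥0∞) :
    ∑' k₁, ∑' k₂, ∑' k₃, γ k₁ * γ k₂ * γ k₃ * γ (k₁ - k₂ + k₃) * E (k₁ - k₂) ≤
      (∑' a, E a) * (∑' k, γ k ^ 2) ^ 2 := by
  calc ∑' k₁, ∑' k₂, ∑' k₃, γ k₁ * γ k₂ * γ k₃ * γ (k₁ - k₂ + k₃) * E (k₁ - k₂)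
      = ∑' k₂, ∑' a, ∑' k₃, γ (a + k₂) * γ k₂ * γ k₃ * γ (k₃ + a) * E a := by
        rw [ENNReal.tsum_comm]
        refine tsum_congr fun k₂ => ?_
        rw [← (Equiv.addRight k₂).tsum_eq]
        refine tsum_congr fun a => tsum_congr fun k₃ => ?_
        simp only [Equiv.coe_addRight, add_sub_cancel_right]
        rw [add_comm a k₃]
    _ = ∑' a, E a * ((∑' k, γ k * γ (k + a)) * ∑' k, γ k * γ (k + a)) := by
        rw [ENNReal.tsum_comm]
        refine tsum_congr fun a => ?_
        rw [← ENNReal.tsum_mul_right, ← ENNReal.tsum_mul_left]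
        refine tsum_congr fun k => ?_
        rw [← ENNReal.tsum_mul_left, ← ENNReal.tsum_mul_left]
        refine tsum_congr fun l => ?_
        rw [add_comm a k]; ring
    _ ≤ ∑' a, E a * ((∑' k, γ k ^ 2) * ∑' k, γ k ^ 2) := by
        refine ENNReal.tsum_le_tsum fun a => ?_
        have := tsum_mul_shift_le γ a
        exact mul_le_mul_right (mul_le_mul' this this) _
    _ = _ := by rw [ENNReal.tsum_mul_right, sq]

/-- The summand apart from `E` is symmetric in `k₁` and `k₃`. -/
theorem tsum_quartic_le' (γ E : ℤ → ℝ≥0∞) :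
    ∑' k₁, ∑' k₂, ∑' k₃, γ k₁ * γ k₂ * γ k₃ * γ (k₁ - k₂ + k₃) * E (k₃ - k₂) ≤
      (∑' a, E a) * (∑' k, γ k ^ 2) ^ 2 := by
  refine le_trans (le_of_eq ?_) (tsum_quartic_le γ E)
  have (k₁ : ℤ) : ∑' k₂, ∑' k₃, γ k₁ * γ k₂ * γ k₃ * γ (k₁ - k₂ + k₃) * E (k₃ - k₂) =
      ∑' k₃, ∑' k₂, γ k₁ * γ k₂ * γ k₃ * γ (k₁ - k₂ + k₃) * E (k₃ - k₂) := ENNReal.tsum_comm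
  simp_rw [this]
  rw [ENNReal.tsum_comm]
  refine tsum_congr fun k₃ => ?_
  rw [ENNReal.tsum_comm]
  refine tsum_congr fun k₂ => tsum_congr fun k₁ => ?_
  rw [show k₁ - k₂ + k₃ = k₃ - k₂ + k₁ by ring]; ring

theorem tsum_int_ofReal_exp_le {s : ℝ} (hs : 0 < s) (hs1 : s ≤ 1) :
    ∑' m : ℤ, ENNReal.ofReal (Real.exp (-(2 * s * (m : ℝ) ^ 4))) ≤
      ENNReal.ofReal (12 * s ^ (-(1 / 4) : ℝ)) := by
  set ε := s ^ (1 / 4 : ℝ) with hε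
  have hε0 : 0 < ε := by positivity
  have hε1 : ε ≤ 1 := Real.rpow_le_one hs.le hs1 (by norm_num)
  have hε4 : ε ^ 4 = s := by
    rw [hε, ← Real.rpow_mul_natCast hs.le]; norm_num
  have hεi : s ^ (-(1 / 4) : ℝ) = ε⁻¹ := Real.rpow_neg hs.le _
  set h : ℝ → ℝ := fun x => (1 + (ε * x) ^ 2)⁻¹ with hh
  -- With `y = εx` one has `exp(2y⁴) ≥ 1 + 2y⁴ ≥ (1 + y²)/2`. The majorant has an explicit
  -- primitive, an arctangent, for the integral comparison.
  have hexp : ∀ x : ℝ, Real.exp (-(2 * s * x ^ 4)) ≤ 2 * h x := by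
    intro x
    rw [hh, Real.exp_neg, ← div_eq_mul_inv, inv_eq_one_div,
      div_le_div_iff₀ (Real.exp_pos _) (by positivity)]
    have := Real.add_one_le_exp (2 * s * x ^ 4)
    have e : 2 * s * x ^ 4 = 2 * ((ε * x) ^ 2) ^ 2 := by rw [← hε4]; ring
    rw [e] at this ⊢
    nlinarith [sq_nonneg (2 * (ε * x) ^ 2 - 1), sq_nonneg (ε * x)]
  have hpart : ∀ n : ℕ, ∑ i ∈ Finset.range n, h ((i + 1 : ℕ) : ℝ) ≤ 2 * ε⁻¹ := by
    intro n
    have hanti : AntitoneOn h (Icc (0 : ℝ) (0 + n)) := by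
      intro x hx y hy hxy
      have := hx.1
      simp only [hh]
      gcongr
    have h1 := hanti.sum_le_integral
    have h2 : ∫ x in (0 : ℝ)..(0 + n), h x = ε⁻¹ * Real.arctan (ε * n) := by
      rw [hh, intervalIntegral.integral_comp_mul_left (fun y => (1 + y ^ 2)⁻¹) hε0.ne',
        integral_inv_one_add_sq]
      simp
    rw [h2] at h1
    simp only [zero_add] at h1
    refine h1.trans ?_
    rw [mul_comm 2]
    gcongr
    linarith [Real.arctan_lt_pi_div_two (ε * n), Real.pi_lt_d2]
  have htsum : ∑' n : ℕ, ENNReal.ofReal (2 * h ((n + 1 : ℕ) : ℝ)) ≤ ENNReal.ofReal (4 * ε⁻¹) := by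
    refine ENNReal.tsum_le_of_sum_range_le fun n => ?_
    rw [← ENNReal.ofReal_sum_of_nonneg (fun i _ => by positivity), ← Finset.mul_sum]
    exact ENNReal.ofReal_le_ofReal (by linarith [hpart n])
  have hintg := (HasSum.of_nat_of_neg_add_one
    (f := fun m : ℤ => ENNReal.ofReal (Real.exp (-(2 * s * (m : ℝ) ^ 4))))
    ENNReal.summable.hasSum ENNReal.summable.hasSum).tsum_eq
  rw [hintg, tsum_eq_zero_add' ENNReal.summable]
  have c1 : ∑' n : ℕ, ENNReal.ofReal (Real.exp (-(2 * s * (((n + 1 : ℕ) : ℤ) : ℝ) ^ 4))) ≤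
      ENNReal.ofReal (4 * ε⁻¹) := by
    refine (ENNReal.tsum_le_tsum fun n => ENNReal.ofReal_le_ofReal ?_).trans htsum
    rw [Int.cast_natCast]
    exact hexp _
  have c2 : ∑' n : ℕ, ENNReal.ofReal (Real.exp (-(2 * s * ((-((n : ℤ) + 1) : ℤ) : ℝ) ^ 4))) ≤
      ENNReal.ofReal (4 * ε⁻¹) := by
    refine (ENNReal.tsum_le_tsum fun n => ENNReal.ofReal_le_ofReal ?_).trans htsum
    have : ((-((n : ℤ) + 1) : ℤ) : ℝ) ^ 4 = ((n + 1 : ℕ) : ℝ) ^ 4 := by push_cast; ring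
    rw [this]
    exact hexp _
  -- The term `m = 0` equals `1` and is absorbed in `s^{-1/4}` because `s ≤ 1`.
  have c0 : ENNReal.ofReal (Real.exp (-(2 * s * (((0 : ℕ) : ℤ) : ℝ) ^ 4))) ≤
      ENNReal.ofReal (ε⁻¹) := by
    apply ENNReal.ofReal_le_ofReal
    simpa using (one_le_inv₀ hε0).2 hε1
  refine (add_le_add (add_le_add c0 c1) c2).trans ?_
  rw [hεi, ← ENNReal.ofReal_add (by positivity) (by positivity),
    ← ENNReal.ofReal_add (by positivity) (by positivity)]
  exact ENNReal.ofReal_le_ofReal (by nlinarith [inv_pos.2 hε0])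

/-! ### The quartic form -/

/-- A term of the trigonometric polynomial `e^{-ixΔ} ∑ cₖ e^{iky}`. -/
def waveTerm (c : ℤ → ℂ) (k : ℤ) (p : ℝ × Torus) : ℂ :=
  c k * Complex.exp (Complex.I * (k : ℂ) ^ 2 * p.1) * fourier k p.2

theorem continuous_waveTerm (c : ℤ → ℂ) (k : ℤ) : Continuous (waveTerm c k) := by
  unfold waveTerm; fun_prop

/-- The resonance function `k₁² - k₂² + k₃² - k₄²`. -/
def resonance (q : (ℤ × ℤ) × ℤ × ℤ) : ℤ := q.1.1 ^ 2 - q.1.2 ^ 2 + (q.2.1 ^ 2 - q.2.2 ^ 2)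

/-- The total frequency `k₁ - k₂ + k₃ - k₄`. -/
def totalFreq (q : (ℤ × ℤ) × ℤ × ℤ) : ℤ := q.1.1 - q.1.2 + (q.2.1 - q.2.2)

theorem norm_sum_waveTerm_pow_four (c : ℤ → ℂ) (S : Finset ℤ) (p : ℝ × Torus) :
    ((‖∑ k ∈ S, waveTerm c k p‖ ^ 4 : ℝ) : ℂ) =
      ∑ q ∈ (S ×ˢ S) ×ˢ (S ×ˢ S), (c q.1.1 * conj (c q.1.2) * (c q.2.1 * conj (c q.2.2))) *
        (Complex.exp ((resonance q : ℝ) * p.1 * Complex.I) * fourier (totalFreq q) p.2) := by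
  have h1 : ((‖∑ k ∈ S, waveTerm c k p‖ ^ 4 : ℝ) : ℂ) =
      ((∑ k ∈ S, waveTerm c k p) * conj (∑ k ∈ S, waveTerm c k p)) *
        ((∑ k ∈ S, waveTerm c k p) * conj (∑ k ∈ S, waveTerm c k p)) := by
    rw [Complex.mul_conj']; push_cast; ring
  rw [h1, map_sum, Finset.sum_mul_sum, ← Finset.sum_product', Finset.sum_mul_sum,
    ← Finset.sum_product']
  refine Finset.sum_congr rfl fun q _ => ?_
  have h2 : ∀ k l : ℤ, waveTerm c k p * conj (waveTerm c l p) = c k * conj (c l) *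
      (Complex.exp (((k ^ 2 - l ^ 2 : ℤ) : ℂ) * p.1 * Complex.I) * fourier (k - l) p.2) := by
    intro k l
    have e1 : conj (Complex.exp (Complex.I * (l : ℂ) ^ 2 * p.1)) =
        Complex.exp (-(Complex.I * (l : ℂ) ^ 2 * p.1)) := by
      rw [← Complex.exp_conj]; simp
    have e2 : Complex.exp (((k ^ 2 - l ^ 2 : ℤ) : ℂ) * p.1 * Complex.I) =
        Complex.exp (Complex.I * (k : ℂ) ^ 2 * p.1) *
          Complex.exp (-(Complex.I * (l : ℂ) ^ 2 * p.1)) := by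
      rw [← Complex.exp_add]; congr 1; push_cast; ring
    simp only [waveTerm, map_mul]
    rw [e1, e2, sub_eq_add_neg, fourier_add, fourier_neg]; ring
  rw [h2, h2]
  have e3 : Complex.exp ((resonance q : ℝ) * p.1 * Complex.I) =
      Complex.exp (((q.1.1 ^ 2 - q.1.2 ^ 2 : ℤ) : ℂ) * p.1 * Complex.I) *
        Complex.exp (((q.2.1 ^ 2 - q.2.2 ^ 2 : ℤ) : ℂ) * p.1 * Complex.I) := by
    rw [← Complex.exp_add, resonance]; congr 1; push_cast; ring
  rw [e3, totalFreq, fourier_add]; ring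

theorem integral_fourier (n : ℤ) :
    ∫ y : Torus, fourier n y ∂torusMeasure = if n = 0 then 1 else 0 := by
  have h := congrFun (fourierCoeff_fourier (T := 2 * Real.pi) n) 0
  simp only [fourierCoeff, neg_zero, fourier_zero, one_smul] at h
  rw [h]
  by_cases hn : n = 0
  · simp [hn]
  · simp [hn, Ne.symm hn]

theorem integral_exp_gaussianReal (v : ℝ≥0) (r : ℝ) :
    ∫ x, Complex.exp (r * x * Complex.I) ∂(gaussianReal 0 v) = Real.exp (-(v * r ^ 2 / 2)) := by
  rw [← charFun_apply_real, charFun_gaussianReal]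
  push_cast; congr 1; ring

/-- After expansion of the fourth power, the integral over the circle selects zero total frequency,
and the Gaussian integral is the characteristic function at the resonance. -/
theorem lintegral_norm_sum_waveTerm_pow_four_le (c : ℤ → ℂ) (S : Finset ℤ) (v : ℝ≥0) :
    ∫⁻ p, ‖∑ k ∈ S, waveTerm c k p‖ₑ ^ 4 ∂((gaussianReal 0 v).prod torusMeasure) ≤
      ∑ q ∈ (S ×ˢ S) ×ˢ (S ×ˢ S), ‖c q.1.1‖ₑ * ‖c q.1.2‖ₑ * (‖c q.2.1‖ₑ * ‖c q.2.2‖ₑ) *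
        (ENNReal.ofReal (Real.exp (-(v * (resonance q : ℝ) ^ 2 / 2))) *
          if totalFreq q = 0 then 1 else 0) := by
  set μ := (gaussianReal 0 v).prod torusMeasure
  have hcont : Continuous fun p => ∑ k ∈ S, waveTerm c k p :=
    continuous_finsetSum _ fun k _ => continuous_waveTerm c k
  have hbd : ∀ p, ‖∑ k ∈ S, waveTerm c k p‖ ≤ ∑ k ∈ S, ‖c k‖ := fun p => by
    refine (norm_sum_le _ _).trans (Finset.sum_le_sum fun k _ => le_of_eq ?_)
    rw [waveTerm, norm_mul, norm_mul, norm_exp_I_mul_sq_mul, fourier_apply, Circle.norm_coe,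
      mul_one, mul_one]
  have hintg : Integrable (fun p => ‖∑ k ∈ S, waveTerm c k p‖ ^ 4) μ := by
    refine Integrable.of_bound (hcont.norm.pow 4).aestronglyMeasurable ((∑ k ∈ S, ‖c k‖) ^ 4)
      (.of_forall fun p => ?_)
    rw [norm_pow, norm_norm]
    gcongr
    exact hbd p
  have e1 : ∫⁻ p, ‖∑ k ∈ S, waveTerm c k p‖ₑ ^ 4 ∂μ =
      ‖∫ p, ((‖∑ k ∈ S, waveTerm c k p‖ ^ 4 : ℝ) : ℂ) ∂μ‖ₑ := by
    rw [integral_complex_ofReal, ← ofReal_norm, Complex.norm_real, Real.norm_of_nonneg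
      (integral_nonneg fun p => by positivity), ofReal_integral_eq_lintegral_ofReal hintg
      (.of_forall fun p => by positivity)]
    refine lintegral_congr fun p => ?_
    rw [ENNReal.ofReal_pow (norm_nonneg _), ofReal_norm]
  rw [e1]
  simp_rw [norm_sum_waveTerm_pow_four]
  rw [integral_finsetSum]
  · refine (enorm_sum_le _ _).trans (Finset.sum_le_sum fun q _ => le_of_eq ?_)
    rw [integral_const_mul, integral_prod_mul (fun x : ℝ => Complex.exp ((resonance q : ℝ) * x *
      Complex.I)) (fun y : Torus => fourier (totalFreq q) y), integral_exp_gaussianReal,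
      integral_fourier]
    simp only [enorm_mul, RCLike.enorm_conj]
    congr 2
    · rw [← ofReal_norm, Complex.norm_real, Real.norm_of_nonneg (Real.exp_pos _).le]
    · split_ifs <;> simp
  · intro q _
    refine Integrable.const_mul ?_ _
    refine Integrable.of_bound (C := 1) (Continuous.aestronglyMeasurable (by fun_prop))
      (.of_forall fun p => ?_)
    rw [norm_mul, fourier_apply, Circle.norm_coe, ← Complex.ofReal_mul,
      Complex.norm_exp_ofReal_mul_I, mul_one]

/-- With the fourth frequency eliminated the resonance is `-2ab`, where `a = k₁ - k₂` and `b = k₃ -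
k₂`, and `a²b² ≥ min(a⁴, b⁴)`. Each of the two weights depends on one difference only, as
`tsum_quartic_le` requires. -/
theorem ofReal_exp_resonance_le (v : ℝ≥0) (k₁ k₂ k₃ : ℤ) :
    ENNReal.ofReal (Real.exp (-(v * (resonance ((k₁, k₂), (k₃, k₁ - k₂ + k₃)) : ℝ) ^ 2 / 2))) ≤
      ENNReal.ofReal (Real.exp (-(2 * v * ((k₁ - k₂ : ℤ) : ℝ) ^ 4))) +
        ENNReal.ofReal (Real.exp (-(2 * v * ((k₃ - k₂ : ℤ) : ℝ) ^ 4))) := by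
  rw [← ENNReal.ofReal_add (Real.exp_pos _).le (Real.exp_pos _).le]
  apply ENNReal.ofReal_le_ofReal
  have e : resonance ((k₁, k₂), (k₃, k₁ - k₂ + k₃)) = -2 * (k₁ - k₂) * (k₃ - k₂) := by
    simp only [resonance]; ring
  rw [e]
  set a : ℝ := ((k₁ - k₂ : ℤ) : ℝ) with ha
  set b : ℝ := ((k₃ - k₂ : ℤ) : ℝ) with hb
  have e2 : ((-2 * (k₁ - k₂) * (k₃ - k₂) : ℤ) : ℝ) = -2 * a * b := by rw [ha, hb]; push_cast; ring
  rw [e2]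
  have hv : (0 : ℝ) ≤ v := v.2
  rcases le_total (a ^ 2) (b ^ 2) with h | h
  · have : Real.exp (-(v * (-2 * a * b) ^ 2 / 2)) ≤ Real.exp (-(2 * v * a ^ 4)) := by
      apply Real.exp_le_exp.2
      have := mul_le_mul_of_nonneg_left (mul_le_mul_of_nonneg_left h (sq_nonneg a)) hv
      nlinarith
    linarith [Real.exp_pos (-(2 * v * b ^ 4))]
  · have : Real.exp (-(v * (-2 * a * b) ^ 2 / 2)) ≤ Real.exp (-(2 * v * b ^ 4)) := by
      apply Real.exp_le_exp.2
      have := mul_le_mul_of_nonneg_left (mul_le_mul_of_nonneg_left h (sq_nonneg b)) hv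
      nlinarith
    linarith [Real.exp_pos (-(2 * v * a ^ 4))]

theorem lintegral_norm_sum_waveTerm_pow_four_le_tsum (c : ℤ → ℂ) (S : Finset ℤ) (v : ℝ≥0) :
    ∫⁻ p, ‖∑ k ∈ S, waveTerm c k p‖ₑ ^ 4 ∂((gaussianReal 0 v).prod torusMeasure) ≤
      2 * (∑' m : ℤ, ENNReal.ofReal (Real.exp (-(2 * v * (m : ℝ) ^ 4)))) *
        (∑' k, ‖c k‖ₑ ^ 2) ^ 2 := by
  refine (lintegral_norm_sum_waveTerm_pow_four_le c S v).trans ?_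
  refine (ENNReal.sum_le_tsum _).trans ?_
  set γ : ℤ → ℝ≥0∞ := fun k => ‖c k‖ₑ with hγ
  set E : ℤ → ℝ≥0∞ := fun m => ENNReal.ofReal (Real.exp (-(2 * v * (m : ℝ) ^ 4))) with hE
  rw [ENNReal.tsum_prod', ENNReal.tsum_prod']
  calc _ = ∑' k₁, ∑' k₂, ∑' k₃, γ k₁ * γ k₂ * γ k₃ * γ (k₁ - k₂ + k₃) * ENNReal.ofReal
          (Real.exp (-(v * (resonance ((k₁, k₂), (k₃, k₁ - k₂ + k₃)) : ℝ) ^ 2 / 2))) := by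
        refine tsum_congr fun k₁ => tsum_congr fun k₂ => ?_
        rw [ENNReal.tsum_prod']
        refine tsum_congr fun k₃ => ?_
        rw [tsum_eq_single (k₁ - k₂ + k₃)]
        · have : totalFreq ((k₁, k₂), (k₃, k₁ - k₂ + k₃)) = 0 := by simp only [totalFreq]; ring
          rw [if_pos this, mul_one]
          ring
        · intro k hk
          have : totalFreq ((k₁, k₂), (k₃, k)) ≠ 0 := by
            simp only [totalFreq]; intro h; apply hk; linarith
          rw [if_neg this, mul_zero, mul_zero]
    _ ≤ ∑' k₁, ∑' k₂, ∑' k₃, (γ k₁ * γ k₂ * γ k₃ * γ (k₁ - k₂ + k₃) * E (k₁ - k₂) +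
          γ k₁ * γ k₂ * γ k₃ * γ (k₁ - k₂ + k₃) * E (k₃ - k₂)) := by
        refine ENNReal.tsum_le_tsum fun k₁ => ENNReal.tsum_le_tsum fun k₂ =>
          ENNReal.tsum_le_tsum fun k₃ => ?_
        rw [← mul_add]
        gcongr
        exact ofReal_exp_resonance_le v k₁ k₂ k₃
    _ ≤ (∑' a, E a) * (∑' k, γ k ^ 2) ^ 2 + (∑' a, E a) * (∑' k, γ k ^ 2) ^ 2 := by
        simp_rw [ENNReal.tsum_add]
        exact add_le_add (tsum_quartic_le γ E) (tsum_quartic_le' γ E)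
    _ = _ := by ring

theorem tsum_enorm_repr_sq (f : L2x) :
    ∑' k, ‖fourierBasis.repr f k‖ₑ ^ 2 = ‖f‖ₑ ^ 2 := by
  have h := lp.hasSum_norm (p := 2) (by norm_num) (fourierBasis.repr f)
  rw [LinearIsometryEquiv.norm_map] at h
  simp only [ENNReal.toReal_ofNat, Real.rpow_ofNat] at h
  have h2 := ENNReal.ofReal_tsum_of_nonneg (fun k => by positivity) h.summable
  rw [h.tsum_eq] at h2
  rw [← ofReal_norm, ← ENNReal.ofReal_pow (norm_nonneg _), h2]
  refine tsum_congr fun k => ?_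
  rw [ENNReal.ofReal_pow (norm_nonneg _), ofReal_norm]

theorem eLpNorm_four_pow_four {α : Type*} {_ : MeasurableSpace α} {μ : Measure α} (f : α → ℂ) :
    eLpNorm f 4 μ ^ 4 = ∫⁻ a, ‖f a‖ₑ ^ 4 ∂μ := by
  rw [eLpNorm_eq_lintegral_rpow_enorm_toReal (by norm_num) (by norm_num),
    ← ENNReal.rpow_natCast, ← ENNReal.rpow_mul]
  norm_num

theorem propagator_partialSum_ae (a : ℝ) (S : Finset ℤ) (f : L2x) :
    propagator a (partialSum S f) =ᵐ[torusMeasure]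
      fun y => ∑ k ∈ S, waveTerm (fourierBasis.repr f) k (a, y) := by
  rw [propagator_partialSum]
  refine (Lp.coeFn_finsetSum _ _).trans ?_
  have h : ∀ᵐ y ∂torusMeasure, ∀ k ∈ S,
      ((fourierBasis.repr f k * Complex.exp (Complex.I * (k : ℂ) ^ 2 * a)) •
        (fourierBasis k : L2x) : L2x) y = waveTerm (fourierBasis.repr f) k (a, y) := by
    rw [eventually_all_finset]
    intro k _
    rw [coe_fourierBasis]
    filter_upwards [Lp.coeFn_smul (fourierBasis.repr f k *
      Complex.exp (Complex.I * (k : ℂ) ^ 2 * a)) (fourierLp (T := 2 * Real.pi) 2 k),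
      coeFn_fourierLp (T := 2 * Real.pi) 2 k] with y h1 h2
    rw [h1, Pi.smul_apply, h2, waveTerm, smul_eq_mul]
  filter_upwards [h] with y hy
  rw [Finset.sum_apply]
  exact Finset.sum_congr rfl hy

theorem lintegral_gaussian_eLpNorm_propagator_partialSum_le (v : ℝ≥0) (S : Finset ℤ) (f : L2x) :
    ∫⁻ x, eLpNorm (propagator x (partialSum S f)) 4 torusMeasure ^ 4 ∂(gaussianReal 0 v) ≤
      2 * (∑' m : ℤ, ENNReal.ofReal (Real.exp (-(2 * v * (m : ℝ) ^ 4)))) * ‖f‖ₑ ^ 4 := by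
  have h := lintegral_norm_sum_waveTerm_pow_four_le_tsum (fourierBasis.repr f) S v
  have hcont : Continuous fun p => ∑ k ∈ S, waveTerm (fourierBasis.repr f) k p :=
    continuous_finsetSum _ fun k _ => continuous_waveTerm _ k
  rw [tsum_enorm_repr_sq, ← pow_mul, 
    lintegral_prod _ (hcont.enorm.measurable.pow_const 4).aemeasurable] at h
  refine le_trans (le_of_eq (lintegral_congr fun x => ?_)) h
  rw [eLpNorm_four_pow_four]
  refine lintegral_congr_ae ?_
  filter_upwards [propagator_partialSum_ae x S f] with y hy
  rw [hy]

/-- Averaging over a Gaussian of variance `v` gains `L⁴` integrability, with a loss of the size of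
`∑ exp(-2vm⁴)`. -/
theorem lintegral_gaussian_eLpNorm_propagator_le (v : ℝ≥0) (f : L2x) :
    ∫⁻ x, eLpNorm (propagator x f) 4 torusMeasure ^ 4 ∂(gaussianReal 0 v) ≤
      2 * (∑' m : ℤ, ENNReal.ofReal (Real.exp (-(2 * v * (m : ℝ) ^ 4)))) * ‖f‖ₑ ^ 4 := by
  -- Fatou's lemma needs a sequence, so one is extracted from the net of finite frequency sets.
  obtain ⟨S, hS⟩ := exists_seq_tendsto (atTop : Filter (Finset ℤ))
  have hlim : ∀ x, Tendsto (fun n => propagator x (partialSum (S n) f)) atTop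
      (𝓝 (propagator x f)) := fun x =>
    ((propagatorₗᵢ x).continuous.tendsto f).comp ((tendsto_partialSum f).comp hS)
  have hmeas : ∀ g : L2x, Measurable fun x => eLpNorm (propagator x g) 4 torusMeasure ^ 4 :=
    fun g => (measurable_eLpNorm_four.comp (continuous_propagator_left g).measurable).pow_const 4
  calc ∫⁻ x, eLpNorm (propagator x f) 4 torusMeasure ^ 4 ∂(gaussianReal 0 v)
      ≤ ∫⁻ x, liminf (fun n => eLpNorm (propagator x (partialSum (S n) f)) 4 torusMeasure ^ 4)
          atTop ∂(gaussianReal 0 v) := by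
        refine lintegral_mono fun x => ?_
        have hmono : Monotone fun y : ℝ≥0∞ => y ^ 4 := fun a b hab => pow_le_pow_left' hab 4
        refine (hmono (eLpNorm_four_le_liminf (hlim x))).trans (le_of_eq ?_)
        exact hmono.map_liminf_of_continuousAt _ (ENNReal.continuous_pow 4).continuousAt
    _ ≤ liminf (fun n => ∫⁻ x, eLpNorm (propagator x (partialSum (S n) f)) 4 torusMeasure ^ 4
          ∂(gaussianReal 0 v)) atTop := lintegral_liminf_le fun n => hmeas _
    _ ≤ _ := (liminf_le_liminf (.of_forall fun n =>
        lintegral_gaussian_eLpNorm_propagator_partialSum_le v (S n) f)).trans (by simp)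

theorem lintegral_gaussian_eLpNorm_propagator_le_rpow {v : ℝ≥0} (hv : 0 < v) (hv1 : v ≤ 1)
    (f : L2x) :
    ∫⁻ x, eLpNorm (propagator x f) 4 torusMeasure ^ 4 ∂(gaussianReal 0 v) ≤
      ENNReal.ofReal (24 * (v : ℝ) ^ (-(1 / 4) : ℝ)) * ‖f‖ₑ ^ 4 := by
  refine (lintegral_gaussian_eLpNorm_propagator_le _ f).trans ?_
  gcongr
  refine (mul_le_mul_right (tsum_int_ofReal_exp_le (s := v) hv hv1) 2).trans (le_of_eq ?_)
  rw [← ENNReal.ofReal_ofNat, ← ENNReal.ofReal_mul (by norm_num)]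
  congr 1; ring

theorem lintegral_rpow_neg_quarter {δ : ℝ} (hδ : 0 < δ) :
    ∫⁻ s in Ioc 0 δ, ENNReal.ofReal (24 * s ^ (-(1 / 4) : ℝ)) =
      32 * ENNReal.ofReal (δ ^ (3 / 4 : ℝ)) := by
  have hintg : IntervalIntegrable (fun s : ℝ => 24 * s ^ (-(1 / 4) : ℝ)) volume 0 δ :=
    (intervalIntegral.intervalIntegrable_rpow' (by norm_num)).const_mul 24
  rw [← ofReal_integral_eq_lintegral_ofReal
    ((intervalIntegrable_iff_integrableOn_Ioc_of_le hδ.le).1 hintg),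
    ← intervalIntegral.integral_of_le hδ.le, intervalIntegral.integral_const_mul,
    integral_rpow (Or.inl (by norm_num)), ← ENNReal.ofReal_ofNat,
    ← ENNReal.ofReal_mul (by norm_num)]
  · congr 1
    rw [Real.zero_rpow (by norm_num), show (-(1 / 4) + 1 : ℝ) = 3 / 4 by norm_num]
    ring
  · filter_upwards [ae_restrict_mem measurableSet_Ioc] with s hs
    have := hs.1
    positivity

end Dispersion

/-! ### Independence of increments, adapted step processes and predictability -/

section Brownian

open Filter Topology

instance : Fact ((2 : ℝ≥0∞) ≠ ∞) := ⟨by norm_num⟩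
instance : Fact ((4 : ℝ≥0∞) ≠ ∞) := ⟨by norm_num⟩
instance : MeasurableSpace L4x := borel _
instance : BorelSpace L4x := ⟨rfl⟩

instance : SecondCountableTopology L2x := Lp.SecondCountableTopology
instance : SecondCountableTopology L4x := Lp.SecondCountableTopology

instance (T : ℝ≥0) : IsFiniteMeasure (timeMeasure T) := by
  unfold timeMeasure; infer_instance

variable {Ω : Type*} {m : MeasurableSpace Ω} {P : Measure Ω} [IsProbabilityMeasure P]
  {ℱ : Filtration ℝ≥0 m} {W : ℝ≥0 → Ω → ℝ}

theorem measurable_propagator : Measurable fun p : ℝ × L2x => propagator p.1 p.2 :=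
  continuous_propagator.measurable

theorem measurable_eLpNorm_propagator :
    Measurable fun p : ℝ × L2x => eLpNorm (propagator p.1 p.2) 4 torusMeasure ^ 4 :=
  (measurable_eLpNorm_four.comp measurable_propagator).pow_const 4

theorem measurable_propagator_comp {α : Type*} {_ : MeasurableSpace α} {X : α → ℝ} {f : α → L2x}
    (hX : Measurable X) (hf : Measurable f) : Measurable fun a => propagator (X a) (f a) :=
  Measurable.comp (f := fun a => (X a, f a)) measurable_propagator (hX.prodMk hf)

theorem stronglyMeasurable_propagator_comp {α : Type*} {_ : MeasurableSpace α} {X : α → ℝ}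
    {f : α → L2x} (hX : StronglyMeasurable X) (hf : StronglyMeasurable f) :
    StronglyMeasurable fun a => propagator (X a) (f a) :=
  (measurable_propagator_comp hX.measurable hf.measurable).stronglyMeasurable

theorem aemeasurable_eLpNorm_propagator_comp {α : Type*} {_ : MeasurableSpace α} {μ : Measure α}
    {X : α → ℝ} {f : α → L2x} (hX : AEMeasurable X μ) (hf : AEMeasurable f μ) :
    AEMeasurable (fun a => eLpNorm (propagator (X a) (f a)) 4 torusMeasure ^ 4) μ :=
  Measurable.comp_aemeasurable (f := fun a => (X a, f a)) measurable_eLpNorm_propagator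
    (hX.prodMk hf)

/-- Independence turns the joint law into a product, so the deterministic estimate can be applied
for each frozen value of `f`. -/
theorem lintegral_eLpNorm_propagator_of_indepFun {X : Ω → ℝ} {f : Ω → L2x} (hX : Measurable X)
    (hf : Measurable f) (hind : IndepFun X f P) {v : ℝ≥0} (hlaw : P.map X = gaussianReal 0 v)
    (hv : 0 < v) (hv1 : v ≤ 1) :
    ∫⁻ ω, eLpNorm (propagator (X ω) (f ω)) 4 torusMeasure ^ 4 ∂P ≤
      ENNReal.ofReal (24 * (v : ℝ) ^ (-(1 / 4) : ℝ)) * ∫⁻ ω, ‖f ω‖ₑ ^ 4 ∂P := by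
  have hprod := (indepFun_iff_map_prod_eq_prod_map_map hX.aemeasurable hf.aemeasurable).1 hind
  have := Measure.isProbabilityMeasure_map (μ := P) hf.aemeasurable
  calc ∫⁻ ω, eLpNorm (propagator (X ω) (f ω)) 4 torusMeasure ^ 4 ∂P
      = ∫⁻ p, eLpNorm (propagator p.1 p.2) 4 torusMeasure ^ 4
          ∂((gaussianReal 0 v).prod (P.map f)) := by
        rw [← hlaw, ← hprod, lintegral_map measurable_eLpNorm_propagator (hX.prodMk hf)]
    _ = ∫⁻ g, ∫⁻ x, eLpNorm (propagator x g) 4 torusMeasure ^ 4 ∂(gaussianReal 0 v)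
          ∂(P.map f) :=
        lintegral_prod_symm _ measurable_eLpNorm_propagator.aemeasurable
    _ ≤ ∫⁻ g, ENNReal.ofReal (24 * (v : ℝ) ^ (-(1 / 4) : ℝ)) * ‖g‖ₑ ^ 4 ∂(P.map f) :=
        lintegral_mono fun g => lintegral_gaussian_eLpNorm_propagator_le_rpow hv hv1 g
    _ = ENNReal.ofReal (24 * (v : ℝ) ^ (-(1 / 4) : ℝ)) * ∫⁻ ω, ‖f ω‖ₑ ^ 4 ∂P := by
        rw [lintegral_map ((measurable_enorm.pow_const 4).const_mul _) hf,
          lintegral_const_mul' _ _ ENNReal.ofReal_ne_top]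

/-- The `L⁴` gain along a Brownian path, for data known at an earlier time. -/
theorem IsBrownianMotion.lintegral_eLpNorm_propagator_le (hW : IsBrownianMotion ℱ W P)
    {s t : ℝ≥0} (hst : s < t) (hts : t ≤ s + 1) {c : Ω → L2x} (hc : Measurable[ℱ s] c) :
    ∫⁻ ω, eLpNorm (propagator (W t ω) (c ω)) 4 torusMeasure ^ 4 ∂P ≤
      ENNReal.ofReal (24 * ((t : ℝ) - s) ^ (-(1 / 4) : ℝ)) * ∫⁻ ω, ‖c ω‖ₑ ^ 4 ∂P := by
  have hfs : Measurable[ℱ s] fun ω => propagator (W s ω) (c ω) :=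
    measurable_propagator_comp (hW.adapted s) hc
  have hWm : ∀ r, Measurable (W r) := fun r => (hW.adapted r).mono (ℱ.le r) le_rfl
  have hind : IndepFun (fun ω => W t ω - W s ω) (fun ω => propagator (W s ω) (c ω)) P := by
    rw [IndepFun_iff_Indep]
    exact indep_of_indep_of_le_right (hW.indep_increment s t hst.le) hfs.comap_le
  have hlaw : P.map (fun ω => W t ω - W s ω) = gaussianReal 0 (t - s) := by
    refine (hW.isBrownianReal.hasLaw_sub t s).map_eq.trans ?_
    congr 1
    rw [← NNReal.coe_inj, coe_nndist, NNReal.coe_sub hst.le]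
    change dist (t : ℝ) s = _
    rw [Real.dist_eq, abs_of_nonneg (sub_nonneg.2 (by exact_mod_cast hst.le))]
  -- The group law splits off the increment: `e^{-iW_tΔ}c = e^{-i(W_t - W_s)Δ}(e^{-iW_sΔ}c)`. The
  -- inner factor is known at time `s` and has the same norm as `c`.
  have h := lintegral_eLpNorm_propagator_of_indepFun ((hWm t).sub (hWm s))
    (hfs.mono (ℱ.le s) le_rfl) hind hlaw (tsub_pos_of_lt hst) (tsub_le_iff_left.2 hts)
  simp only [propagator_propagator, Pi.sub_apply, sub_add_cancel, NNReal.coe_sub hst.le] at h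
  refine h.trans (le_of_eq ?_)
  congr 1
  refine lintegral_congr fun ω => ?_
  rw [← ofReal_norm, ← ofReal_norm, norm_propagator]

theorem IsBrownianMotion.setLIntegral_cell_le (hW : IsBrownianMotion ℱ W P) {δ : ℝ} (hδ : 0 < δ)
    (hδ1 : δ ≤ 1) (k : ℕ) {c : Ω → L2x} (hc : Measurable[ℱ (k * δ).toNNReal] c) :
    ∫⁻ t in cell δ k, ∫⁻ ω, eLpNorm (propagator (W t.toNNReal ω) (c ω)) 4 torusMeasure ^ 4 ∂P ≤
      32 * ENNReal.ofReal (δ ^ (3 / 4 : ℝ)) * ∫⁻ ω, ‖c ω‖ₑ ^ 4 ∂P := by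
  have hk : 0 ≤ k * δ := by positivity
  calc ∫⁻ t in cell δ k, ∫⁻ ω, eLpNorm (propagator (W t.toNNReal ω) (c ω)) 4 torusMeasure ^ 4 ∂P
      ≤ ∫⁻ t in cell δ k, ENNReal.ofReal (24 * (t - k * δ) ^ (-(1 / 4) : ℝ)) *
          ∫⁻ ω, ‖c ω‖ₑ ^ 4 ∂P := by
        refine setLIntegral_mono' (measurableSet_cell δ k) fun t ht => ?_
        have h1 : k * δ < t := ht.1
        have h2 : t ≤ (k + 1 : ℕ) * δ := ht.2
        push_cast at h2
        have h0 : 0 ≤ t := hk.trans h1.le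
        have := hW.lintegral_eLpNorm_propagator_le (s := (k * δ).toNNReal) (t := t.toNNReal)
          ((Real.toNNReal_lt_toNNReal_iff (hk.trans_lt h1)).2 h1) (by
            rw [← NNReal.coe_le_coe, NNReal.coe_add, Real.coe_toNNReal _ hk,
              Real.coe_toNNReal _ h0, NNReal.coe_one]
            linarith) hc
        rwa [Real.coe_toNNReal _ hk, Real.coe_toNNReal _ h0] at this
    _ ≤ (∫⁻ t in cell δ k, ENNReal.ofReal (24 * (t - k * δ) ^ (-(1 / 4) : ℝ))) *
          ∫⁻ ω, ‖c ω‖ₑ ^ 4 ∂P := by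
        rw [lintegral_mul_const _ (by fun_prop)]
    _ = _ := by
        have h := setLIntegral_cell_eq δ 0 k fun s => ENNReal.ofReal (24 * s ^ (-(1 / 4) : ℝ))
        rw [zero_add] at h
        rw [← h, cell, ← lintegral_rpow_neg_quarter hδ]
        simp

/-- The index `k` of the time cell `(kδ, (k + 1)δ]` that contains `t`. -/
def cellIndex (δ t : ℝ) : ℕ := ⌈t / δ⌉₊ - 1

theorem mem_cell_cellIndex {δ t : ℝ} (hδ : 0 < δ) (ht : 0 < t) : t ∈ cell δ (cellIndex δ t) := by
  have h1 : 0 < ⌈t / δ⌉₊ := Nat.ceil_pos.2 (by positivity)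
  have h2 : cellIndex δ t + 1 = ⌈t / δ⌉₊ := by unfold cellIndex; omega
  constructor
  · have : cellIndex δ t < ⌈t / δ⌉₊ := by omega
    rw [Nat.lt_ceil, lt_div_iff₀ hδ] at this
    exact this
  · rw [h2, ← div_le_iff₀ hδ]
    exact Nat.le_ceil _

theorem cellIndex_eq_of_mem {δ t : ℝ} (hδ : 0 < δ) {k : ℕ} (ht : t ∈ cell δ k) :
    cellIndex δ t = k := by
  have : ⌈t / δ⌉₊ = k + 1 := by
    rw [Nat.ceil_eq_iff (by omega)]
    rw [lt_div_iff₀ hδ, div_le_iff₀ hδ]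
    exact ht
  rw [cellIndex, this]; rfl

theorem measurable_cellIndex (δ : ℝ) : Measurable (cellIndex δ) := by
  unfold cellIndex
  exact (measurable_from_top (f := fun n : ℕ => n - 1)).comp (Nat.measurable_ceil.comp (by fun_prop))

theorem iUnion_cell {δ : ℝ} (hδ : 0 < δ) : ⋃ k, cell δ k = Ioi 0 := by
  ext t
  simp only [mem_iUnion, mem_Ioi]
  refine ⟨fun ⟨k, hk⟩ => lt_of_le_of_lt (by positivity) hk.1, fun h => ⟨_, mem_cell_cellIndex hδ h⟩⟩

theorem measurable_stepProcess {E : Type*} {_ : MeasurableSpace E} (δ : ℝ) {c : ℕ → Ω → E}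
    (hc : ∀ k, Measurable (c k)) :
    Measurable fun p : ℝ≥0 × Ω => c (cellIndex δ p.1) p.2 :=
  (measurable_from_prod_countable_right (f := fun q : ℕ × Ω => c q.1 q.2) hc).comp
    (((measurable_cellIndex δ).comp (measurable_coe_nnreal_real.comp measurable_fst)).prodMk
      measurable_snd)

/-- The `L⁴` gain along a Brownian path, for an adapted step process. -/
theorem IsBrownianMotion.lintegral_stepProcess_le (hW : IsBrownianMotion ℱ W P) (T : ℝ≥0)
    (hWm : AEMeasurable (Function.uncurry W) ((timeMeasure T).prod P)) {δ : ℝ}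
    (hδ : 0 < δ) (hδ1 : δ ≤ 1) {c : ℕ → Ω → L2x} (hc : ∀ k : ℕ, Measurable[ℱ (k * δ).toNNReal] (c k)) :
    ∫⁻ p, eLpNorm (propagator (W p.1 p.2) (c (cellIndex δ p.1) p.2)) 4 torusMeasure ^ 4
        ∂((timeMeasure T).prod P) ≤
      32 * ENNReal.ofReal (δ ^ (3 / 4 : ℝ)) * ∫⁻ ω, ∑' k, ‖c k ω‖ₑ ^ 4 ∂P := by
  have hcm : ∀ k, Measurable (c k) := fun k => (hc k).mono (ℱ.le _) le_rfl
  have hm : AEMeasurable (fun p : ℝ≥0 × Ω =>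
      eLpNorm (propagator (W p.1 p.2) (c (cellIndex δ p.1) p.2)) 4 torusMeasure ^ 4)
      ((timeMeasure T).prod P) :=
    aemeasurable_eLpNorm_propagator_comp hWm (measurable_stepProcess δ hcm).aemeasurable
  rw [lintegral_prod _ hm, lintegral_tsum fun k => ((hcm k).enorm.pow_const 4).aemeasurable,
    ← ENNReal.tsum_mul_left]
  -- The inequality for pushforwards needs no measurability of the integrand. Next, `(0, T)` is
  -- enlarged to `(0, ∞)` so that it is a union of whole cells; this makes the bound independent of
  -- `T`.
  refine (lintegral_map_le _ _).trans ?_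
  refine (lintegral_mono_set (t := Ioi 0) fun t ht => ht.1).trans ?_
  rw [← iUnion_cell hδ, lintegral_iUnion (measurableSet_cell δ) (pairwise_disjoint_cell hδ.le)]
  refine ENNReal.tsum_le_tsum fun k => ?_
  refine le_trans (le_of_eq (setLIntegral_congr_fun (measurableSet_cell δ k) fun t ht => ?_))
    (hW.setLIntegral_cell_le hδ hδ1 k (hc k))
  have ht0 : 0 ≤ t := (lt_of_le_of_lt (by positivity : (0 : ℝ) ≤ k * δ) ht.1).le
  simp only [Real.coe_toNNReal t ht0, cellIndex_eq_of_mem hδ ht]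

/-! ### Predictability -/

theorem predictable_le_prod (ℱ : Filtration ℝ≥0 m) :
    ℱ.predictable ≤ (inferInstance : MeasurableSpace (ℝ≥0 × Ω)) :=
  measurableSpace_le_predictable_of_measurableSet
    (fun _ hA => (measurableSet_singleton _).prod (ℱ.le _ _ hA))
    (fun _ _ hA => measurableSet_Ioi.prod (ℱ.le _ _ hA))

theorem measurable_predictable_stepProcess {δ : ℝ} (hδ : 0 < δ) {c : ℕ → Ω → ℝ}
    (hc : ∀ k : ℕ, Measurable[ℱ (k * δ).toNNReal] (c k)) :
    Measurable[ℱ.predictable] fun p : ℝ≥0 × Ω => c (cellIndex δ p.1) p.2 := by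
  intro A hA
  have h : (fun p : ℝ≥0 × Ω => c (cellIndex δ p.1) p.2) ⁻¹' A =
      ({⊥} ×ˢ (c 0 ⁻¹' A)) ∪
        ⋃ k : ℕ, Ioc (k * δ).toNNReal ((k + 1 : ℕ) * δ).toNNReal ×ˢ (c k ⁻¹' A) := by
    ext ⟨t, ω⟩
    simp only [mem_preimage, mem_union, mem_prod, mem_singleton_iff, mem_iUnion]
    have hcell : ∀ k : ℕ, t ∈ Ioc (k * δ).toNNReal ((k + 1 : ℕ) * δ).toNNReal ↔
        (t : ℝ) ∈ cell δ k := fun k => by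
      rw [cell, mem_Ioc, mem_Ioc, Real.toNNReal_lt_iff_lt_coe (by positivity),
        Real.le_toNNReal_iff_coe_le (by positivity)]
    simp only [hcell]
    rcases eq_or_ne t 0 with rfl | ht
    · have h0 : cellIndex δ ((0 : ℝ≥0) : ℝ) = 0 := by simp [cellIndex]
      rw [h0]
      refine ⟨fun h => Or.inl ⟨rfl, h⟩, ?_⟩
      rintro (h | ⟨k, hk, -⟩)
      · exact h.2
      · exact absurd hk.1 (not_lt.2 (by simpa using (by positivity : (0 : ℝ) ≤ k * δ)))
    · have ht' : (0 : ℝ) < t := by positivity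
      refine ⟨fun h => Or.inr ⟨_, mem_cell_cellIndex hδ ht', h⟩, ?_⟩
      rintro (h | ⟨k, hk, h⟩)
      · exact absurd h.1 ht
      · rwa [cellIndex_eq_of_mem hδ hk]
  rw [h]
  refine MeasurableSet.union (measurableSet_predictable_singleton_bot_prod ?_)
    (MeasurableSet.iUnion fun k => measurableSet_predictable_Ioc_prod _ _ (hc k hA))
  have h0 : (((0 : ℕ) : ℝ) * δ).toNNReal = ⊥ := by simp
  rw [← h0]
  exact hc 0 hA

/-- A Brownian motion is almost everywhere equal to a predictable process. -/
theorem IsBrownianMotion.exists_predictable (hW : IsBrownianMotion ℱ W P) (T : ℝ≥0) :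
    ∃ V : ℝ≥0 × Ω → ℝ, StronglyMeasurable[ℱ.predictable] V ∧
      Function.uncurry W =ᵐ[(timeMeasure T).prod P] V := by
  set X : ℕ → ℝ≥0 × Ω → ℝ := fun n p =>
    W (cellIndex ((1 / 2 : ℝ) ^ n) p.1 * (1 / 2 : ℝ) ^ n).toNNReal p.2 with hX
  have hXm : ∀ n, StronglyMeasurable[ℱ.predictable] (X n) := fun n =>
    (measurable_predictable_stepProcess (δ := (1 / 2 : ℝ) ^ n)
      (c := fun k => W (k * (1 / 2 : ℝ) ^ n).toNNReal) (by positivity)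
      fun k => hW.adapted _).stronglyMeasurable
  refine ⟨_, @StronglyMeasurable.limUnder _ _ _ ℱ.predictable _ _ atTop _ _ _ _ hXm, ?_⟩
  -- The approximations sample `W` at the left endpoint of the dyadic cell containing `t`, which
  -- tends to `t`. Paths are continuous only almost surely, hence equality almost everywhere.
  have hcont : ∀ᵐ p ∂((timeMeasure T).prod P), Continuous fun t => W t p.2 :=
    Measure.quasiMeasurePreserving_snd.ae hW.isBrownianReal.cont
  filter_upwards [hcont] with p hp
  refine (Tendsto.limUnder_eq ?_).symm
  refine (hp.tendsto p.1).comp ?_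
  have h : Tendsto (fun n : ℕ => cellIndex ((1 / 2 : ℝ) ^ n) p.1 * (1 / 2 : ℝ) ^ n) atTop
      (𝓝 (p.1 : ℝ)) := by
    have h2 : Tendsto (fun n : ℕ => (1 / 2 : ℝ) ^ n) atTop (𝓝 0) :=
      tendsto_pow_atTop_nhds_zero_of_lt_one (by norm_num) (by norm_num)
    rcases eq_or_ne p.1 0 with h0 | h0
    · simp [h0, cellIndex]
    · have ht' : (0 : ℝ) < p.1 := by positivity
      have h3 : Tendsto (fun n : ℕ => (p.1 : ℝ) - (1 / 2 : ℝ) ^ n) atTop (𝓝 ((p.1 : ℝ) - 0)) :=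
        tendsto_const_nhds.sub h2
      rw [sub_zero] at h3
      refine tendsto_of_tendsto_of_tendsto_of_le_of_le h3 tendsto_const_nhds (fun n => ?_)
        (fun n => ?_)
      · have := (mem_cell_cellIndex (δ := (1 / 2 : ℝ) ^ n) (by positivity) ht').2
        push_cast at this
        dsimp only
        linarith
      · exact (mem_cell_cellIndex (δ := (1 / 2 : ℝ) ^ n) (by positivity) ht').1.le
  have := (continuous_real_toNNReal.tendsto _).comp h
  rwa [Real.toNNReal_coe] at this

theorem stronglyMeasurable_cellAvg {E : Type*} [NormedAddCommGroup E] [InnerProductSpace ℂ E]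
    {α : Type*} {_ : MeasurableSpace α} (δ : ℝ) (i : ℕ) {F : α → ℝ → E}
    (hF : StronglyMeasurable (Function.uncurry F)) :
    StronglyMeasurable fun a => cellAvg δ (F a) i :=
  (StronglyMeasurable.integral_prod_right (ν := volume.restrict (cell δ i)) hF).const_smul δ⁻¹

/-- The average of a predictable process over a time cell is known at the end of the cell. -/
theorem stronglyMeasurable_cellAvg_predictable {E : Type*} [NormedAddCommGroup E]
    [InnerProductSpace ℂ E] (δ : ℝ) (i : ℕ)
    {Y : ℝ≥0 × Ω → E} (hY : StronglyMeasurable[ℱ.predictable] Y) :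
    StronglyMeasurable[ℱ ((i + 1 : ℕ) * δ).toNNReal]
      fun ω => cellAvg δ (fun t => Y (t.toNNReal, ω)) i := by
  set s := ((i + 1 : ℕ) * δ).toNNReal with hs
  -- Progressive measurability makes `Y` jointly measurable for `ℱ s` up to time `s`. Capping the
  -- time at `s` does not change `Y` on the cell.
  have hprog := IsStronglyPredictable.isStronglyProgressive (𝓕 := ℱ) (u := fun t ω => Y (t, ω)) hY s
  have h1 : Measurable[(ℱ s).prod inferInstance, Subtype.instMeasurableSpace.prod (ℱ s)]
      fun q : Ω × ℝ => ((⟨min q.2.toNNReal s, mem_Iic.2 (min_le_right _ _)⟩ : Iic s), q.1) := by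
    refine Measurable.prodMk (Measurable.subtype_mk ?_) (@measurable_fst _ _ (ℱ s) _)
    exact (measurable_real_toNNReal.comp (@measurable_snd _ _ (ℱ s) _)).min measurable_const
  have h2 := @stronglyMeasurable_cellAvg _ _ _ Ω (ℱ s) δ i
    (fun ω t => Y (min t.toNNReal s, ω)) (hprog.comp_measurable h1)
  convert h2 using 2 with ω
  rw [cellAvg, cellAvg]
  congr 1
  refine setIntegral_congr_fun (measurableSet_cell δ i) fun t ht => ?_
  have h3 : t.toNNReal ≤ s := Real.toNNReal_le_toNNReal ht.2
  simp only [min_eq_left h3]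

end Brownian

/-! ### Time measure, summation inequalities and convergence of the causal approximations -/

section Assembly

open Filter Topology

/-! ### Time measure -/

theorem measurableEmbedding_nnreal_coe : MeasurableEmbedding ((↑) : ℝ≥0 → ℝ) :=
  MeasurableEmbedding.subtype_coe measurableSet_Ici

theorem timeMeasure_map_coe (T : ℝ≥0) :
    (timeMeasure T).map ((↑) : ℝ≥0 → ℝ) = volume.restrict (Ioo (0 : ℝ) T) := by
  rw [timeMeasure, Measure.map_map measurable_coe_nnreal_real measurable_real_toNNReal]
  conv_rhs => rw [← Measure.map_id (μ := volume.restrict (Ioo (0 : ℝ) T))]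
  refine Measure.map_congr ?_
  filter_upwards [ae_restrict_mem measurableSet_Ioo] with s hs
  exact Real.coe_toNNReal s hs.1.le

theorem ae_timeMeasure_iff {T : ℝ≥0} {p : ℝ≥0 → Prop} :
    (∀ᵐ t ∂(timeMeasure T), p t) ↔ ∀ᵐ s ∂(volume.restrict (Ioo (0 : ℝ) T)), p s.toNNReal := by
  rw [← timeMeasure_map_coe, measurableEmbedding_nnreal_coe.ae_map_iff]
  simp

theorem lintegral_timeMeasure (T : ℝ≥0) (F : ℝ≥0 → ℝ≥0∞) :
    ∫⁻ t, F t ∂(timeMeasure T) = ∫⁻ s in Ioo (0 : ℝ) T, F s.toNNReal := by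
  rw [← timeMeasure_map_coe, measurableEmbedding_nnreal_coe.lintegral_map]
  simp

/-! ### Summation -/

theorem tsum_mul_sq_le (w F : ℕ → ℝ≥0∞) :
    (∑' n, w n * F n) ^ 2 ≤ (∑' n, w n) * ∑' n, w n * F n ^ 2 := by
  have h := lintegral_sq_le_measure_mul (Measure.sum fun n => w n • Measure.dirac n)
    (measurable_from_top (f := F)).aemeasurable
  simpa [lintegral_sum_measure, lintegral_smul_measure] using h

/-- Hölder's inequality with weights `rⁿ`, as two applications of Cauchy–Schwarz. It replaces the
triangle inequality in `L⁴` over the scales. -/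
theorem tsum_pow_four_le {r : ℝ≥0∞} (hr0 : r ≠ 0) (hr : r ≠ ∞) (x : ℕ → ℝ≥0∞) :
    (∑' n, x n) ^ 4 ≤ (∑' n, r ^ n) ^ 3 * ∑' n, (r⁻¹ ^ 3) ^ n * x n ^ 4 := by
  set F : ℕ → ℝ≥0∞ := fun n => r⁻¹ ^ n * x n
  have hrr : ∀ n, r ^ n * r⁻¹ ^ n = 1 := fun n => by
    rw [← mul_pow, ENNReal.mul_inv_cancel hr0 hr, one_pow]
  have h1 : ∀ n, x n = r ^ n * F n := fun n => by rw [← mul_assoc, hrr, one_mul]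
  have h2 : ∀ n, (r⁻¹ ^ 3) ^ n * x n ^ 4 = r ^ n * F n ^ 4 := fun n => by
    calc (r⁻¹ ^ 3) ^ n * x n ^ 4 = (r ^ n * r⁻¹ ^ n) * ((r⁻¹ ^ 3) ^ n * x n ^ 4) := by
          rw [hrr, one_mul]
      _ = r ^ n * (r⁻¹ ^ n * x n) ^ 4 := by ring
  have h3 := tsum_mul_sq_le (fun n => r ^ n) F
  have h4 := tsum_mul_sq_le (fun n => r ^ n) fun n => F n ^ 2
  calc (∑' n, x n) ^ 4 = ((∑' n, r ^ n * F n) ^ 2) ^ 2 := by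
        rw [← pow_mul]; congr 1; exact tsum_congr h1
    _ ≤ ((∑' n, r ^ n) * ∑' n, r ^ n * F n ^ 2) ^ 2 := by gcongr
    _ = (∑' n, r ^ n) ^ 2 * (∑' n, r ^ n * F n ^ 2) ^ 2 := by ring
    _ ≤ (∑' n, r ^ n) ^ 2 * ((∑' n, r ^ n) * ∑' n, r ^ n * (F n ^ 2) ^ 2) := by gcongr
    _ = (∑' n, r ^ n) ^ 3 * ∑' n, r ^ n * F n ^ 4 := by
        rw [← mul_assoc, ← pow_succ]; simp only [← pow_mul, Nat.reduceMul]
    _ = _ := by simp only [h2]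

theorem tsum_sq_le_sq_tsum {ι : Type*} (x : ι → ℝ≥0∞) : ∑' k, x k ^ 2 ≤ (∑' k, x k) ^ 2 := by
  rw [sq (∑' k, x k), ← ENNReal.tsum_mul_right]
  refine ENNReal.tsum_le_tsum fun k => ?_
  rw [sq]
  gcongr
  exact ENNReal.le_tsum k

/-- Transfers bounds valid for every extension to the restriction norm. Extensions are thus used
path by path, and none has to be chosen measurably or adaptedly in `ω`. -/
theorem le_mul_sobolevNorm_pow {H : Type*} [NormedAddCommGroup H] [InnerProductSpace ℂ H]
    [CompleteSpace H] {b : ℝ} {T : ℝ≥0} {f : ℝ≥0 → H} {X A : ℝ≥0∞} (hA0 : A ≠ 0) (hA : A ≠ ∞)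
    {n : ℕ} (hn : n ≠ 0)
    (h : ∀ g : Lp H 2 (volume : Measure ℝ), (∀ᵐ t : ℝ≥0 ∂(timeMeasure T), g (t : ℝ) = f t) →
      X ≤ A * lineSobolevNorm b g ^ n) :
    X ≤ A * sobolevNorm b T f ^ n := by
  have hn' : (0 : ℝ) < n := by positivity
  have h1 : (X / A) ^ ((n : ℝ)⁻¹) ≤ sobolevNorm b T f := by
    refine le_iInf₂ fun g hg => ?_
    rw [ENNReal.rpow_inv_le_iff hn', ENNReal.rpow_natCast, ENNReal.div_le_iff' hA0 hA]
    exact h g hg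
  rwa [ENNReal.rpow_inv_le_iff hn', ENNReal.rpow_natCast, ENNReal.div_le_iff' hA0 hA] at h1

/-! ### Increments of the causal approximations -/

section Increments

variable {H : Type*} [NormedAddCommGroup H] [InnerProductSpace ℂ H] [CompleteSpace H]

/-- The increments of the causal step function approximations of `f`, starting from `0`. -/
def stepIncr (f : ℝ → H) : ℕ → ℕ → H
  | 0, k => stepCoeff f 0 k
  | j + 1, k => stepDiff f j k

theorem cellIndex_half {δ t : ℝ} (hδ : 0 < δ) (ht : 0 < t) :
    cellIndex (2 * δ) t = cellIndex δ t / 2 := by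
  apply cellIndex_eq_of_mem (by positivity)
  obtain ⟨h1, h2⟩ := mem_cell_cellIndex hδ ht
  set k := cellIndex δ t
  have h3 : 2 * (k / 2) ≤ k := by omega
  have h4 : k + 1 ≤ 2 * (k / 2 + 1) := by omega
  have h3' : (2 : ℝ) * ((k / 2 : ℕ) : ℝ) ≤ k := by exact_mod_cast h3
  have h4' : ((k + 1 : ℕ) : ℝ) ≤ 2 * ((k / 2 + 1 : ℕ) : ℝ) := by exact_mod_cast h4
  constructor
  · nlinarith
  · nlinarith

theorem sum_stepIncr (f : ℝ → H) {t : ℝ} (ht : 0 < t) (J : ℕ) :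
    ∑ n ∈ Finset.range (J + 1), stepIncr f n (cellIndex ((1 / 2 : ℝ) ^ n) t) =
      stepCoeff f J (cellIndex ((1 / 2 : ℝ) ^ J) t) := by
  induction J with
  | zero => simp [stepIncr]
  | succ J ih =>
    rw [Finset.sum_range_succ, ih, stepIncr, stepDiff]
    have : cellIndex ((1 / 2 : ℝ) ^ J) t = cellIndex ((1 / 2 : ℝ) ^ (J + 1)) t / 2 := by
      rw [← cellIndex_half (by positivity) ht]; congr 1; rw [pow_succ]; ring
    rw [this]; abel

/-- Causality: the averaging cell ends at the start of cell `k`, before `T`, so the coefficient does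
not see the extension beyond `(0, T)`. -/
theorem stepCoeff_congr {f g : ℝ → H} {T : ℝ}
    (h : ∀ᵐ t ∂(volume.restrict (Ioo (0 : ℝ) T)), f t = g t) {j k : ℕ}
    (hk : k * (1 / 2 : ℝ) ^ j < T) : stepCoeff f j k = stepCoeff g j k := by
  unfold stepCoeff
  split_ifs with hk0
  · rfl
  · unfold cellAvg
    congr 1
    refine integral_congr_ae (ae_restrict_of_ae_restrict_of_subset (fun t ht => ?_) h)
    have e : k - 1 + 1 = k := by omega
    refine ⟨lt_of_le_of_lt (by positivity) ht.1, lt_of_le_of_lt ht.2 ?_⟩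
    rwa [e]

theorem stepIncr_congr {f g : ℝ → H} {T : ℝ}
    (h : ∀ᵐ t ∂(volume.restrict (Ioo (0 : ℝ) T)), f t = g t) {n k : ℕ}
    (hk : k * (1 / 2 : ℝ) ^ n < T) : stepIncr f n k = stepIncr g n k := by
  cases n with
  | zero => exact stepCoeff_congr h hk
  | succ j =>
    rw [stepIncr, stepIncr, stepDiff, stepDiff, stepCoeff_congr h hk, stepCoeff_congr h]
    refine lt_of_le_of_lt ?_ hk
    have h3 : 2 * (k / 2) ≤ k := by omega
    have h3' : (2 : ℝ) * ((k / 2 : ℕ) : ℝ) ≤ k := by exact_mod_cast h3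
    rw [pow_succ]
    have : (0 : ℝ) < (1 / 2) ^ j := by positivity
    nlinarith

theorem tsum_enorm_stepIncr_sq_le {b : ℝ} (hb0 : 0 ≤ b) (hb1 : b ≤ 3 / 8)
    (g : Lp H 2 (volume : Measure ℝ)) (n : ℕ) :
    ∑' k, ‖stepIncr g n k‖ₑ ^ 2 ≤
      180 * ENNReal.ofReal (2 * (1 / 2 : ℝ) ^ (2 * b)) ^ n * lineSobolevNorm b g ^ 2 := by
  cases n with
  | zero =>
    refine (tsum_enorm_stepCoeff_zero_sq_le hb0 g).trans ?_
    rw [pow_zero, mul_one]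
    exact le_mul_of_one_le_left' (by norm_num)
  | succ j =>
    have h := tsum_enorm_stepDiff_sq_le hb0 hb1 g j
    have h2 : (2 : ℝ≥0∞) ^ (j + 1) * ENNReal.ofReal ((1 / 2 : ℝ) ^ (j + 1)) = 1 := by
      rw [← ENNReal.ofReal_ofNat, ← ENNReal.ofReal_pow (by norm_num),
        ← ENNReal.ofReal_mul (by positivity), ← mul_pow]
      norm_num
    calc ∑' k, ‖stepDiff g j k‖ₑ ^ 2
        = 2 ^ (j + 1) * (ENNReal.ofReal ((1 / 2 : ℝ) ^ (j + 1)) *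
            ∑' k, ‖stepDiff g j k‖ₑ ^ 2) := by rw [← mul_assoc, h2, one_mul]
      _ ≤ 2 ^ (j + 1) * (180 * ENNReal.ofReal ((1 / 2 : ℝ) ^ (2 * b)) ^ (j + 1) *
            lineSobolevNorm b g ^ 2) := by gcongr
      _ = _ := by
          rw [ENNReal.ofReal_mul (by norm_num), mul_pow, ENNReal.ofReal_ofNat]; ring

/-- The causal step function approximations of an integrable function converge to it almost
everywhere. -/
theorem ae_tendsto_stepCoeff {f : ℝ → H} {T : ℝ} (hf : IntegrableOn f (Ioo 0 T)) :
    ∀ᵐ t ∂(volume.restrict (Ioo (0 : ℝ) T)),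
      Tendsto (fun J => stepCoeff f J (cellIndex ((1 / 2 : ℝ) ^ J) t)) atTop (𝓝 (f t)) := by
  set F := (Ioo (0 : ℝ) T).indicator f with hF
  have hFi : Integrable F := (integrable_indicator_iff measurableSet_Ioo).2 hf
  -- Lebesgue differentiation along balls not centered at `t`. The previous cell is the ball of
  -- radius `δ/2` about `(k - 1/2)δ`, and `t` is within `3δ/2` of that center, hence the factor `3`.
  have h := IsUnifLocDoublingMeasure.ae_tendsto_average (μ := volume) hFi.locallyIntegrable 3
  have hδ : Tendsto (fun J : ℕ => (1 / 2 : ℝ) ^ J) atTop (𝓝 0) :=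
    tendsto_pow_atTop_nhds_zero_of_lt_one (by norm_num) (by norm_num)
  have hδ2 : Tendsto (fun J : ℕ => (1 / 2 : ℝ) ^ J / 2) atTop (𝓝[>] 0) := by
    refine tendsto_nhdsWithin_iff.2 ⟨by simpa using hδ.div_const 2, .of_forall fun J => ?_⟩
    exact mem_Ioi.2 (by positivity)
  filter_upwards [ae_restrict_of_ae h, ae_restrict_mem measurableSet_Ioo] with t ht htT
  have hFt : F t = f t := indicator_of_mem htT f
  rw [← hFt]
  refine (ht (fun J => ((cellIndex ((1 / 2 : ℝ) ^ J) t : ℝ) - 1 / 2) * (1 / 2 : ℝ) ^ J)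
    (fun J => (1 / 2 : ℝ) ^ J / 2) hδ2 (.of_forall fun J => ?_)).congr' ?_
  · obtain ⟨h1, h2⟩ := mem_cell_cellIndex (δ := (1 / 2 : ℝ) ^ J) (by positivity) htT.1
    push_cast at h2
    rw [Real.closedBall_eq_Icc]
    constructor <;> nlinarith
  -- Once `2⁻ᴶ < t` the point has left the first cell, where the step function is `0` by convention.
  · filter_upwards [hδ.eventually_lt_const htT.1] with J hJ
    set δ : ℝ := (1 / 2 : ℝ) ^ J
    have hδ0 : 0 < δ := by positivity
    obtain ⟨h1, h2⟩ := mem_cell_cellIndex (δ := δ) hδ0 htT.1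
    set k := cellIndex δ t
    have hk : k ≠ 0 := by
      intro hk
      rw [hk] at h2
      simp at h2
      linarith
    obtain ⟨i, hi⟩ := Nat.exists_eq_succ_of_ne_zero hk
    rw [stepCoeff, if_neg hk, cellAvg, setAverage_eq, Real.closedBall_eq_Icc,
      integral_Icc_eq_integral_Ioc]
    have e1 : ((k : ℝ) - 1 / 2) * δ - δ / 2 = (k - 1 : ℕ) * δ := by
      rw [hi]; push_cast [Nat.succ_sub_one]; ring
    have e2 : ((k : ℝ) - 1 / 2) * δ + δ / 2 = (k - 1 + 1 : ℕ) * δ := by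
      rw [hi]; push_cast [Nat.succ_sub_one]; ring
    have e3 : volume.real (Icc (((k - 1 : ℕ) : ℝ) * δ) ((k - 1 + 1 : ℕ) * δ)) = δ := by
      rw [Measure.real, Real.volume_Icc, ENNReal.toReal_ofReal]
      · push_cast; ring
      · push_cast; nlinarith
    rw [e1, e2, e3]
    change _ = δ⁻¹ • ∫ t in cell δ (k - 1), f t
    congr 1
    refine setIntegral_congr_fun measurableSet_Ioc fun s hs => ?_
    have e4 : k - 1 + 1 = k := by omega
    have hs2 := hs.2
    rw [e4] at hs2
    have hmem : s ∈ Ioo (0 : ℝ) T :=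
      ⟨lt_of_le_of_lt (by positivity) hs.1, by linarith [htT.2]⟩
    exact indicator_of_mem hmem f

end Increments

end Assembly

/-! ### Summation over scales and the Strichartz estimate -/

section Strichartz

open Filter Topology

variable {Ω : Type*} {m : MeasurableSpace Ω} {P : Measure Ω} [IsProbabilityMeasure P]
  {ℱ : Filtration ℝ≥0 m} {W : ℝ≥0 → Ω → ℝ}

/-- The path of the process `Y` at `ω`, as a function on the real line. -/
def realPath (Y : ℝ≥0 × Ω → L2x) (ω : Ω) : ℝ → L2x := fun t => Y (t.toNNReal, ω)

/-- The increments of the causal approximations of the paths of `Y`, on the cells that meet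
`(0, T)`. -/
def truncIncr (T : ℝ≥0) (Y : ℝ≥0 × Ω → L2x) (n k : ℕ) (ω : Ω) : L2x :=
  if k * (1 / 2 : ℝ) ^ n < T then stepIncr (realPath Y ω) n k else 0

theorem stronglyMeasurable_stepCoeff {Y : ℝ≥0 × Ω → L2x}
    (hY : StronglyMeasurable[ℱ.predictable] Y) (j k : ℕ) :
    StronglyMeasurable[ℱ (k * (1 / 2 : ℝ) ^ j).toNNReal]
      fun ω => stepCoeff (realPath Y ω) j k := by
  cases k with
  | zero => simpa [stepCoeff] using stronglyMeasurable_const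
  | succ i =>
    exact stronglyMeasurable_cellAvg_predictable ((1 / 2 : ℝ) ^ j) i hY

theorem stronglyMeasurable_stepIncr {Y : ℝ≥0 × Ω → L2x}
    (hY : StronglyMeasurable[ℱ.predictable] Y) (n k : ℕ) :
    StronglyMeasurable[ℱ (k * (1 / 2 : ℝ) ^ n).toNNReal]
      fun ω => stepIncr (realPath Y ω) n k := by
  cases n with
  | zero => exact stronglyMeasurable_stepCoeff hY 0 k
  | succ j =>
    refine (stronglyMeasurable_stepCoeff hY (j + 1) k).sub
      ((stronglyMeasurable_stepCoeff hY j (k / 2)).mono (ℱ.mono ?_))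
    apply Real.toNNReal_le_toNNReal
    have h3 : 2 * (k / 2) ≤ k := by omega
    have h3' : (2 : ℝ) * ((k / 2 : ℕ) : ℝ) ≤ k := by exact_mod_cast h3
    rw [pow_succ]
    have : (0 : ℝ) < (1 / 2) ^ j := by positivity
    nlinarith

theorem measurable_truncIncr (T : ℝ≥0) {Y : ℝ≥0 × Ω → L2x}
    (hY : StronglyMeasurable[ℱ.predictable] Y) (n k : ℕ) :
    Measurable[ℱ (k * (1 / 2 : ℝ) ^ n).toNNReal] (truncIncr T Y n k) := by
  unfold truncIncr
  by_cases h : k * (1 / 2 : ℝ) ^ n < T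
  · simpa only [if_pos h] using (stronglyMeasurable_stepIncr hY n k).measurable
  · simpa only [if_neg h] using measurable_const

theorem realPath_ae_eq {T : ℝ≥0} {f : ℝ≥0 → L2x} {Y : ℝ≥0 × Ω → L2x} {ω : Ω}
    (hω : ∀ᵐ t ∂(timeMeasure T), f t = Y (t, ω)) {g : Lp L2x 2 (volume : Measure ℝ)}
    (hg : ∀ᵐ t : ℝ≥0 ∂(timeMeasure T), g (t : ℝ) = f t) :
    ∀ᵐ s ∂(volume.restrict (Ioo (0 : ℝ) T)), realPath Y ω s = g s := by
  rw [ae_timeMeasure_iff] at hω hg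
  filter_upwards [hω, hg, ae_restrict_mem measurableSet_Ioo] with s h1 h2 h3
  rw [realPath, ← h1, ← h2, Real.coe_toNNReal s h3.1.le]

theorem tsum_enorm_truncIncr_le {b : ℝ} (hb0 : 0 ≤ b) (hb1 : b ≤ 3 / 8) {T : ℝ≥0}
    {f : ℝ≥0 → L2x} {Y : ℝ≥0 × Ω → L2x} {ω : Ω}
    (hω : ∀ᵐ t ∂(timeMeasure T), f t = Y (t, ω)) (n : ℕ) :
    ∑' k, ‖truncIncr T Y n k ω‖ₑ ^ 4 ≤
      180 ^ 2 * (ENNReal.ofReal (2 * (1 / 2 : ℝ) ^ (2 * b)) ^ n) ^ 2 * sobolevNorm b T f ^ 4 := by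
  refine le_mul_sobolevNorm_pow (mul_ne_zero (by norm_num) (pow_ne_zero _ (pow_ne_zero _ ?_)))
    (ENNReal.mul_ne_top (by norm_num) (by finiteness)) (by norm_num) fun g hg => ?_
  · simpa using (by positivity : (0 : ℝ) < 2 * (1 / 2 : ℝ) ^ (2 * b))
  have hYg := realPath_ae_eq hω hg
  calc ∑' k, ‖truncIncr T Y n k ω‖ₑ ^ 4 ≤ ∑' k, (‖stepIncr g n k‖ₑ ^ 2) ^ 2 := by
        refine ENNReal.tsum_le_tsum fun k => ?_
        rw [← pow_mul]
        unfold truncIncr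
        split_ifs with h
        · rw [stepIncr_congr hYg h]
        · simp
    _ ≤ (∑' k, ‖stepIncr g n k‖ₑ ^ 2) ^ 2 := tsum_sq_le_sq_tsum _
    _ ≤ (180 * ENNReal.ofReal (2 * (1 / 2 : ℝ) ^ (2 * b)) ^ n * lineSobolevNorm b g ^ 2) ^ 2 := by
        gcongr
        exact tsum_enorm_stepIncr_sq_le hb0 hb1 g n
    _ = _ := by ring

theorem lintegral_enorm_sq_le_sobolevNorm {b : ℝ} (hb0 : 0 ≤ b) {T : ℝ≥0}
    {f : ℝ≥0 → L2x} {Y : ℝ≥0 × Ω → L2x} {ω : Ω}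
    (hω : ∀ᵐ t ∂(timeMeasure T), f t = Y (t, ω)) :
    ∫⁻ t, ‖Y (t, ω)‖ₑ ^ 2 ∂(timeMeasure T) ≤ sobolevNorm b T f ^ 2 := by
  rw [← one_mul (sobolevNorm b T f ^ 2)]
  refine le_mul_sobolevNorm_pow one_ne_zero ENNReal.one_ne_top (by norm_num) fun g hg => ?_
  have hYg := realPath_ae_eq hω hg
  rw [one_mul, lintegral_timeMeasure]
  refine le_trans ?_ (lintegral_enorm_sq_le_lineSobolevNorm hb0 g)
  refine le_trans (le_of_eq (lintegral_congr_ae ?_)) (setLIntegral_le_lintegral _ _)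
  filter_upwards [hYg] with s hs
  rw [← hs]; rfl

/-- The geometric rate of the contributions of the successive time scales. -/
def rate (b : ℝ) : ℝ≥0∞ := ENNReal.ofReal ((2 : ℝ) ^ (5 / 16 - b))

theorem rate_ne_zero (b : ℝ) : rate b ≠ 0 := by
  simpa [rate] using (by positivity : (0 : ℝ) < (2 : ℝ) ^ (5 / 16 - b))

theorem rate_lt_one {b : ℝ} (hb : 5 / 16 < b) : rate b < 1 := by
  rw [rate, ENNReal.ofReal_lt_one]
  exact Real.rpow_lt_one_of_one_lt_of_neg (by norm_num) (by linarith)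

/-- The origin of `5/16`: in powers of `2ⁿ`, the exponents are `-3/4 + 2(1 - 2b) = 4(5/16 - b)`. -/
theorem ofReal_rpow_mul_eq_rate (b : ℝ) (n : ℕ) :
    ENNReal.ofReal (((1 / 2 : ℝ) ^ n) ^ (3 / 4 : ℝ)) *
      (ENNReal.ofReal (2 * (1 / 2 : ℝ) ^ (2 * b)) ^ n) ^ 2 = (rate b ^ n) ^ 4 := by
  have h2 : (1 / 2 : ℝ) = 2 ^ (-1 : ℝ) := by rw [Real.rpow_neg_one]; norm_num
  have e1 : ((1 / 2 : ℝ) ^ n) ^ (3 / 4 : ℝ) = 2 ^ (-(3 / 4 * n) : ℝ) := by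
    rw [h2, ← Real.rpow_mul_natCast (by norm_num), ← Real.rpow_mul (by norm_num)]
    congr 1; ring
  have e2 : ((2 * (1 / 2 : ℝ) ^ (2 * b)) ^ n) ^ 2 = 2 ^ ((1 - 2 * b) * n * 2) := by
    have : 2 * (1 / 2 : ℝ) ^ (2 * b) = 2 ^ (1 - 2 * b) := by
      rw [h2, ← Real.rpow_mul (by norm_num), sub_eq_add_neg, Real.rpow_add (by norm_num),
        Real.rpow_one]
      congr 2; ring
    rw [this, ← Real.rpow_mul_natCast (by norm_num), ← Real.rpow_mul_natCast (by norm_num)]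
    norm_num
  have e3 : (((2 : ℝ) ^ (5 / 16 - b)) ^ n) ^ 4 = 2 ^ ((5 / 16 - b) * n * 4) := by
    rw [← Real.rpow_mul_natCast (by norm_num), ← Real.rpow_mul_natCast (by norm_num)]
    norm_num
  rw [rate, ← ENNReal.ofReal_pow (by positivity), ← ENNReal.ofReal_pow (by positivity),
    ← ENNReal.ofReal_pow (by positivity), ← ENNReal.ofReal_pow (by positivity),
    ← ENNReal.ofReal_mul (by positivity), e1, e2, e3, ← Real.rpow_add (by norm_num)]
  congr 2; ring

/-- The `L⁴` norm in space of the contribution of the `n`-th time scale. -/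
def scaleNorm (W : ℝ≥0 → Ω → ℝ) (T : ℝ≥0) (Y : ℝ≥0 × Ω → L2x) (n : ℕ) (p : ℝ≥0 × Ω) : ℝ≥0∞ :=
  eLpNorm (propagator (W p.1 p.2) (truncIncr T Y n (cellIndex ((1 / 2 : ℝ) ^ n) p.1) p.2)) 4
    torusMeasure

theorem aemeasurable_scaleNorm_pow {T : ℝ≥0}
    (hWm : AEMeasurable (Function.uncurry W) ((timeMeasure T).prod P)) {Y : ℝ≥0 × Ω → L2x}
    (hY : StronglyMeasurable[ℱ.predictable] Y) (n : ℕ) :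
    AEMeasurable (fun p => scaleNorm W T Y n p ^ 4) ((timeMeasure T).prod P) :=
  aemeasurable_eLpNorm_propagator_comp hWm (measurable_stepProcess _ fun k =>
    (measurable_truncIncr T hY n k).mono (ℱ.le _) le_rfl).aemeasurable

/-- The dispersive gain `δ^{3/4}` meets the square of the `ℓ²` bound on the increments. -/
theorem IsBrownianMotion.lintegral_scaleNorm_le (hW : IsBrownianMotion ℱ W P) {T : ℝ≥0}
    (hWm : AEMeasurable (Function.uncurry W) ((timeMeasure T).prod P)) {b : ℝ} (hb0 : 0 ≤ b)
    (hb1 : b ≤ 3 / 8) {ψ : ℝ≥0 → Ω → L2x} {Y : ℝ≥0 × Ω → L2x}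
    (hY : StronglyMeasurable[ℱ.predictable] Y)
    (hψ : ∀ᵐ ω ∂P, ∀ᵐ t ∂(timeMeasure T), ψ t ω = Y (t, ω)) (n : ℕ) :
    ∫⁻ p, scaleNorm W T Y n p ^ 4 ∂((timeMeasure T).prod P) ≤
      32 * 180 ^ 2 * (rate b ^ n) ^ 4 * ∫⁻ ω, sobolevNorm b T (fun t => ψ t ω) ^ 4 ∂P := by
  refine (hW.lintegral_stepProcess_le T hWm (δ := (1 / 2 : ℝ) ^ n) (by positivity)
    (pow_le_one₀ (by norm_num) (by norm_num)) fun k => measurable_truncIncr T hY n k).trans ?_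
  have h : ∫⁻ ω, ∑' k, ‖truncIncr T Y n k ω‖ₑ ^ 4 ∂P ≤
      ∫⁻ ω, 180 ^ 2 * (ENNReal.ofReal (2 * (1 / 2 : ℝ) ^ (2 * b)) ^ n) ^ 2 *
        sobolevNorm b T (fun t => ψ t ω) ^ 4 ∂P := by
    refine lintegral_mono_ae ?_
    filter_upwards [hψ] with ω hω
    exact tsum_enorm_truncIncr_le hb0 hb1 hω n
  rw [lintegral_const_mul' _ _ (ENNReal.mul_ne_top (by norm_num) (by finiteness))] at h
  calc _ ≤ 32 * ENNReal.ofReal (((1 / 2 : ℝ) ^ n) ^ (3 / 4 : ℝ)) *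
        (180 ^ 2 * (ENNReal.ofReal (2 * (1 / 2 : ℝ) ^ (2 * b)) ^ n) ^ 2 *
          ∫⁻ ω, sobolevNorm b T (fun t => ψ t ω) ^ 4 ∂P) := by gcongr
    _ = 32 * 180 ^ 2 * (ENNReal.ofReal (((1 / 2 : ℝ) ^ n) ^ (3 / 4 : ℝ)) *
        (ENNReal.ofReal (2 * (1 / 2 : ℝ) ^ (2 * b)) ^ n) ^ 2) *
          ∫⁻ ω, sobolevNorm b T (fun t => ψ t ω) ^ 4 ∂P := by ring
    _ = _ := by rw [ofReal_rpow_mul_eq_rate]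

/-- The contributions of all time scales sum up in `L⁴`. -/
theorem IsBrownianMotion.lintegral_tsum_scaleNorm_le (hW : IsBrownianMotion ℱ W P) {T : ℝ≥0}
    (hWm : AEMeasurable (Function.uncurry W) ((timeMeasure T).prod P)) {b : ℝ} (hb0 : 0 ≤ b)
    (hb1 : b ≤ 3 / 8) {ψ : ℝ≥0 → Ω → L2x} {Y : ℝ≥0 × Ω → L2x}
    (hY : StronglyMeasurable[ℱ.predictable] Y)
    (hψ : ∀ᵐ ω ∂P, ∀ᵐ t ∂(timeMeasure T), ψ t ω = Y (t, ω)) :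
    ∫⁻ p, (∑' n, scaleNorm W T Y n p) ^ 4 ∂((timeMeasure T).prod P) ≤
      32 * 180 ^ 2 * (∑' n, rate b ^ n) ^ 4 *
        ∫⁻ ω, sobolevNorm b T (fun t => ψ t ω) ^ 4 ∂P := by
  set M := ∫⁻ ω, sobolevNorm b T (fun t => ψ t ω) ^ 4 ∂P
  set r := rate b with hr
  have hr0 : r ≠ 0 := rate_ne_zero b
  have hrt : r ≠ ∞ := ENNReal.ofReal_ne_top
  have hmn : ∀ n, AEMeasurable (fun p => (r⁻¹ ^ 3) ^ n * scaleNorm W T Y n p ^ 4)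
      ((timeMeasure T).prod P) := fun n => (aemeasurable_scaleNorm_pow hWm hY n).const_mul _
  have hrr : ∀ n : ℕ, (r⁻¹ ^ 3) ^ n * (r ^ n) ^ 4 = r ^ n := fun n => by
    calc (r⁻¹ ^ 3) ^ n * (r ^ n) ^ 4 = ((r⁻¹ * r) ^ n) ^ 3 * r ^ n := by ring
      _ = _ := by rw [ENNReal.inv_mul_cancel hr0 hrt]; simp
  calc ∫⁻ p, (∑' n, scaleNorm W T Y n p) ^ 4 ∂((timeMeasure T).prod P)
      ≤ ∫⁻ p, (∑' n, r ^ n) ^ 3 * ∑' n, (r⁻¹ ^ 3) ^ n * scaleNorm W T Y n p ^ 4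
          ∂((timeMeasure T).prod P) := lintegral_mono fun p => tsum_pow_four_le hr0 hrt _
    _ = (∑' n, r ^ n) ^ 3 * ∑' n, (r⁻¹ ^ 3) ^ n *
          ∫⁻ p, scaleNorm W T Y n p ^ 4 ∂((timeMeasure T).prod P) := by
        rw [lintegral_const_mul'' _ (AEMeasurable.tsum hmn), lintegral_tsum hmn]
        congr 1
        refine tsum_congr fun n => ?_
        rw [lintegral_const_mul'' _ (aemeasurable_scaleNorm_pow hWm hY n)]
    _ ≤ (∑' n, r ^ n) ^ 3 * ∑' n, (r⁻¹ ^ 3) ^ n * (32 * 180 ^ 2 * (r ^ n) ^ 4 * M) := by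
        gcongr with n
        exact hW.lintegral_scaleNorm_le hWm hb0 hb1 hY hψ n
    _ = (∑' n, r ^ n) ^ 3 * ∑' n, r ^ n * (32 * 180 ^ 2 * M) := by
        congr 1
        refine tsum_congr fun n => ?_
        calc (r⁻¹ ^ 3) ^ n * (32 * 180 ^ 2 * (r ^ n) ^ 4 * M)
            = ((r⁻¹ ^ 3) ^ n * (r ^ n) ^ 4) * (32 * 180 ^ 2 * M) := by ring
          _ = _ := by rw [hrr]
    _ = _ := by rw [ENNReal.tsum_mul_right]; ring

theorem eLpNorm_propagator_sum_le (a : ℝ) (s : Finset ℕ) (f : ℕ → L2x) :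
    eLpNorm (propagator a (∑ n ∈ s, f n)) 4 torusMeasure ≤
      ∑ n ∈ s, eLpNorm (propagator a (f n)) 4 torusMeasure := by
  have e : propagator a (∑ n ∈ s, f n) = ∑ n ∈ s, propagator a (f n) :=
    map_sum (propagatorₗᵢ a) f s
  rw [e, eLpNorm_congr_ae (Lp.coeFn_finsetSum s fun n => propagator a (f n))]
  exact eLpNorm_sum_le (fun n _ => Lp.aestronglyMeasurable _) (by norm_num)

/-- Along an integrable path, the `L⁴` norm is bounded by the contributions of the time scales. -/
theorem ae_eLpNorm_le_tsum_scaleNorm {T : ℝ≥0} {Y : ℝ≥0 × Ω → L2x} {ω : Ω}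
    (hω : IntegrableOn (realPath Y ω) (Ioo (0 : ℝ) T)) :
    ∀ᵐ t ∂(timeMeasure T),
      eLpNorm (propagator (W t ω) (Y (t, ω))) 4 torusMeasure ≤ ∑' n, scaleNorm W T Y n (t, ω) := by
  rw [ae_timeMeasure_iff]
  filter_upwards [ae_tendsto_stepCoeff hω, ae_restrict_mem measurableSet_Ioo] with s hs hsT
  have hlim : Tendsto (fun J => propagator (W s.toNNReal ω)
      (stepCoeff (realPath Y ω) J (cellIndex ((1 / 2 : ℝ) ^ J) s))) atTop
      (𝓝 (propagator (W s.toNNReal ω) (Y (s.toNNReal, ω)))) :=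
    ((propagatorₗᵢ (W s.toNNReal ω)).continuous.tendsto _).comp hs
  refine (eLpNorm_four_le_liminf hlim).trans ?_
  refine (liminf_le_liminf (v := fun _ => ∑' n, scaleNorm W T Y n (s.toNNReal, ω))
    -- The step function at scale `J` telescopes into the increments of scales `0` to `J`. The cells
    -- containing a point of `(0, T)` start before `T`, so truncation removes none of them.
    (.of_forall fun J => ?_)).trans (by simp)
  rw [← sum_stepIncr _ hsT.1]
  refine (eLpNorm_propagator_sum_le _ _ _).trans (le_trans (le_of_eq ?_) 
    (ENNReal.sum_le_tsum (Finset.range (J + 1))))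
  refine Finset.sum_congr rfl fun n _ => ?_
  have hk : cellIndex ((1 / 2 : ℝ) ^ n) s * (1 / 2 : ℝ) ^ n < T :=
    (mem_cell_cellIndex (δ := (1 / 2 : ℝ) ^ n) (by positivity) hsT.1).1.trans hsT.2
  simp only [scaleNorm, truncIncr, Real.coe_toNNReal s hsT.1.le, if_pos hk]

theorem ae_integrableOn_realPath {b : ℝ} (hb0 : 0 ≤ b) {T : ℝ≥0} {ψ : ℝ≥0 → Ω → L2x}
    {Y : ℝ≥0 × Ω → L2x} (hY : Measurable Y)
    (hψ : ∀ᵐ ω ∂P, ∀ᵐ t ∂(timeMeasure T), ψ t ω = Y (t, ω))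
    (hM : ∫⁻ ω, sobolevNorm b T (fun t => ψ t ω) ^ 4 ∂P ≠ ∞) :
    ∀ᵐ ω ∂P, IntegrableOn (realPath Y ω) (Ioo (0 : ℝ) T) := by
  have hm2 : Measurable fun ω => ∫⁻ t, ‖Y (t, ω)‖ₑ ^ 2 ∂(timeMeasure T) :=
    Measurable.lintegral_prod_left' (f := fun p => ‖Y p‖ₑ ^ 2) (hY.enorm.pow_const 2)
  -- The Sobolev norm, an infimum over extensions, is not known to be measurable in `ω`. Almost sure
  -- finiteness is therefore derived for the measurable `L²` integral that it dominates.
  have hle : ∫⁻ ω, (∫⁻ t, ‖Y (t, ω)‖ₑ ^ 2 ∂(timeMeasure T)) ^ 2 ∂P ≠ ∞ := by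
    refine ne_top_of_le_ne_top hM (lintegral_mono_ae ?_)
    filter_upwards [hψ] with ω hω
    calc _ ≤ (sobolevNorm b T (fun t => ψ t ω) ^ 2) ^ 2 := by
          gcongr
          exact lintegral_enorm_sq_le_sobolevNorm hb0 hω
      _ = _ := by rw [← pow_mul]
  filter_upwards [ae_lt_top (hm2.pow_const 2) hle] with ω hω
  have hYω : Measurable (realPath Y ω) :=
    hY.comp (measurable_real_toNNReal.prodMk measurable_const)
  refine ⟨hYω.aestronglyMeasurable, ?_⟩
  have h2 : ∫⁻ t, ‖Y (t, ω)‖ₑ ^ 2 ∂(timeMeasure T) ≠ ∞ := fun h => by simp [h] at hω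
  rw [lintegral_timeMeasure] at h2
  have h1 := lintegral_sq_le_measure_mul (volume.restrict (Ioo (0 : ℝ) T))
    (F := fun s => ‖realPath Y ω s‖ₑ) hYω.enorm.aemeasurable
  have h3 : (∫⁻ s in Ioo (0 : ℝ) T, ‖realPath Y ω s‖ₑ) ^ 2 ≠ ∞ :=
    ne_top_of_le_ne_top (ENNReal.mul_ne_top (measure_ne_top _ _) h2) h1
  rw [HasFiniteIntegral, lt_top_iff_ne_top]
  intro h
  simp [h] at h3

/-! ### The embedding of `L⁴` into `L²` -/

/-- The inclusion of `L⁴(𝕋)` in `L²(𝕋)`. -/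
def inclL4 (f : L4x) : L2x :=
  ((Lp.memLp f).mono_exponent (by norm_num : (2 : ℝ≥0∞) ≤ 4)).toLp _

theorem inclL4_ae (f : L4x) : inclL4 f =ᵐ[torusMeasure] f := MemLp.coeFn_toLp _

theorem continuous_inclL4 : Continuous inclL4 := by
  refine LipschitzWith.continuous (K := 1) fun f g => ?_
  rw [ENNReal.coe_one, one_mul, inclL4, inclL4, Lp.edist_toLp_toLp, Lp.edist_def]
  exact eLpNorm_le_eLpNorm_of_exponent_le (by norm_num)
    ((Lp.aestronglyMeasurable f).sub (Lp.aestronglyMeasurable g))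

theorem injective_inclL4 : Function.Injective inclL4 := fun f g h =>
  Lp.ext ((inclL4_ae f).symm.trans (h ▸ inclL4_ae g))

/-- There is a measurable map that sends the elements of `L²(𝕋)` that are in `L⁴(𝕋)` to
themselves. -/
theorem exists_measurable_toL4 : ∃ G : L2x → L4x, Measurable G ∧
    ∀ f : L2x, eLpNorm f 4 torusMeasure < ∞ → (G f : Torus → ℂ) =ᵐ[torusMeasure] f := by
  -- Lusin–Souslin: a continuous injection between Polish spaces is a measurable embedding, so its
  -- inverse extends measurably to all of `L²`.
  obtain ⟨G, hG, hG2⟩ := (continuous_inclL4.measurableEmbedding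
    injective_inclL4).exists_measurable_extend measurable_id fun _ => ⟨0⟩
  refine ⟨G, hG, fun f hf => ?_⟩
  have hmem : MemLp f 4 torusMeasure := ⟨Lp.aestronglyMeasurable f, hf⟩
  have h1 : inclL4 (hmem.toLp f) = f :=
    Lp.ext ((inclL4_ae _).trans (MemLp.coeFn_toLp hmem))
  have h2 : G f = hmem.toLp f := by
    conv_lhs => rw [← h1]
    exact congrFun hG2 (hmem.toLp f)
  rw [h2]
  exact MemLp.coeFn_toLp hmem

/-! ### The estimate -/

/-- The constant in the Strichartz estimate. -/
def strichartzConst (b : ℝ) : ℝ≥0∞ := (32 * 180 ^ 2 * (∑' n, rate b ^ n) ^ 4) ^ (1 / 4 : ℝ)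

theorem strichartzConst_ne_top {b : ℝ} (hb : 5 / 16 < b) : strichartzConst b ≠ ∞ := by
  refine ENNReal.rpow_ne_top_of_nonneg (by norm_num) (ENNReal.mul_ne_top (by norm_num) ?_)
  refine ENNReal.pow_ne_top ?_
  rw [ENNReal.tsum_geometric]
  exact ENNReal.inv_ne_top.2 (tsub_pos_of_lt (rate_lt_one hb)).ne'

theorem IsBrownianMotion.memL4_and_l4Norm_le (hW : IsBrownianMotion ℱ W P) {b : ℝ}
    (hb : 5 / 16 < b) (hb1 : b ≤ 3 / 8) {T : ℝ≥0} {u : ℝ≥0 → Ω → L2x} (hu : MemX ℱ W P b T u) :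
    MemL4 ℱ P T u ∧ l4Norm P T u ≤ strichartzConst b * xNorm W P b T u := by
  have hb0 : 0 ≤ b := by linarith
  set μ := (timeMeasure T).prod P with hμ
  obtain ⟨Y, hY, huY⟩ := hu.predictable
  obtain ⟨V, hV, hWV⟩ := hW.exists_predictable T
  have hYm : Measurable Y := (hY.mono (predictable_le_prod ℱ)).measurable
  have hVm : Measurable V := (hV.mono (predictable_le_prod ℱ)).measurable
  have hWm : AEMeasurable (Function.uncurry W) μ := ⟨V, hVm, hWV⟩
  set M := ∫⁻ ω, sobolevNorm b T (fun t => untwist W u t ω) ^ 4 ∂P with hM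
  have hMtop : M ≠ ∞ := by
    intro h
    have := hu.norm_lt_top
    rw [xNorm, ← hM, h] at this
    simp at this
  have swap : ∀ {p : ℝ≥0 × Ω → Prop}, (∀ᵐ z ∂μ, p z) →
      ∀ᵐ ω ∂P, ∀ᵐ t ∂(timeMeasure T), p (t, ω) := fun {p} h => by
    rw [hμ, ← Measure.prod_swap] at h
    exact Measure.ae_ae_of_ae_prod (ae_of_ae_map measurable_swap.aemeasurable h)
  have hψ : ∀ᵐ ω ∂P, ∀ᵐ t ∂(timeMeasure T), untwist W u t ω = Y (t, ω) := swap huY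
  have huW : ∀ t ω, u t ω = propagator (W t ω) (untwist W u t ω) := fun t ω => by
    rw [untwist, propagator_propagator, add_neg_cancel, propagator_zero]
  -- A genuinely predictable version of `u`, built from predictable versions of `W` and of the
  -- untwisted process.
  set w : ℝ≥0 × Ω → L2x := fun p => propagator (V p) (Y p) with hw
  have hwp : StronglyMeasurable[ℱ.predictable] w :=
    stronglyMeasurable_propagator_comp hV hY
  have hwm : Measurable w := measurable_propagator_comp hVm hYm
  have huw : ∀ᵐ p ∂μ, u p.1 p.2 = w p := by
    filter_upwards [huY, hWV] with p h1 h2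
    rw [huW, hw]
    simp only [← h1, ← h2]
    rfl
  have hφw : Measurable fun p => eLpNorm (w p) 4 torusMeasure ^ 4 :=
    (measurable_eLpNorm_four.comp hwm).pow_const 4
  have hintg : ∫⁻ ω, ∫⁻ t, eLpNorm (u t ω) 4 torusMeasure ^ 4 ∂(timeMeasure T) ∂P =
      ∫⁻ p, eLpNorm (w p) 4 torusMeasure ^ 4 ∂μ := by
    rw [hμ, lintegral_prod_symm _ hφw.aemeasurable]
    refine lintegral_congr_ae ?_
    filter_upwards [swap huw] with ω hω
    refine lintegral_congr_ae ?_
    filter_upwards [hω] with t ht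
    rw [ht]
  have hbound : ∫⁻ ω, ∫⁻ t, eLpNorm (u t ω) 4 torusMeasure ^ 4 ∂(timeMeasure T) ∂P ≤
      32 * 180 ^ 2 * (∑' n, rate b ^ n) ^ 4 * M := by
    refine le_trans ?_ (hW.lintegral_tsum_scaleNorm_le hWm hb0 hb1 hY hψ)
    have hsm : AEMeasurable (fun p => (∑' n, scaleNorm W T Y n p) ^ 4) μ := by
      refine (AEMeasurable.tsum fun n => ?_).pow_const 4
      have h4 : ∀ x : ℝ≥0∞, (x ^ 4) ^ (1 / 4 : ℝ) = x := fun x => by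
        rw [← ENNReal.rpow_natCast, ← ENNReal.rpow_mul]; norm_num
      simpa only [h4] using (aemeasurable_scaleNorm_pow hWm hY n).pow_const (1 / 4 : ℝ)
    rw [lintegral_prod_symm _ hsm]
    refine lintegral_mono_ae ?_
    filter_upwards [ae_integrableOn_realPath hb0 hYm hψ hMtop, hψ] with ω h1 h2
    refine lintegral_mono_ae ?_
    filter_upwards [ae_eLpNorm_le_tsum_scaleNorm (W := W) h1, h2] with t h3 h4
    rw [huW, h4]
    gcongr
  have hfin : 32 * 180 ^ 2 * (∑' n, rate b ^ n) ^ 4 * M ≠ ∞ := by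
    refine ENNReal.mul_ne_top (fun h => strichartzConst_ne_top hb ?_) hMtop
    rw [strichartzConst, h]; simp
  have hle : l4Norm P T u ≤ strichartzConst b * xNorm W P b T u := by
    rw [l4Norm, strichartzConst, xNorm, ← ENNReal.mul_rpow_of_nonneg _ _ (by norm_num)]
    exact ENNReal.rpow_le_rpow hbound (by norm_num)
  refine ⟨⟨?_, hle.trans_lt
    (ENNReal.mul_lt_top (strichartzConst_ne_top hb).lt_top hu.norm_lt_top)⟩, hle⟩
  obtain ⟨G, hG, hG2⟩ := exists_measurable_toL4
  refine ⟨fun t ω => G (w (t, ω)), ⟨fun p => G (w p), ?_, .of_forall fun p => rfl⟩, ?_⟩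
  · exact (hG.comp hwp.measurable).stronglyMeasurable
  · have hlt : ∀ᵐ p ∂μ, eLpNorm (w p) 4 torusMeasure ^ 4 < ∞ :=
      ae_lt_top hφw (hintg ▸ ne_top_of_le_ne_top hfin hbound)
    filter_upwards [huw, hlt] with p h1 h2
    rw [h1]
    refine hG2 (w p) (lt_top_iff_ne_top.2 fun h => ?_)
    simp [h] at h2

theorem MemX.mono {b b' : ℝ} (hb : b ≤ b') {T : ℝ≥0} {u : ℝ≥0 → Ω → L2x}
    (hu : MemX ℱ W P b' T u) :
    MemX ℱ W P b T u ∧ xNorm W P b T u ≤ xNorm W P b' T u := by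
  have h : xNorm W P b T u ≤ xNorm W P b' T u := by
    refine ENNReal.rpow_le_rpow (lintegral_mono fun ω => ?_) (by norm_num)
    gcongr
    exact sobolevNorm_mono hb T _
  exact ⟨⟨hu.predictable, h.trans_lt hu.norm_lt_top⟩, h⟩

end Strichartz

end StochasticFourierRestriction

end

open StochasticFourierRestriction in
theorem theorem3p3 (b : ℝ) (hb : 5 / 16 < b) :
    ∃ C : ℝ≥0, ∀ (Ω : Type*) (m : MeasurableSpace Ω) (P : Measure Ω) (_ : IsProbabilityMeasure P)
      (ℱ : Filtration ℝ≥0 m) (W : ℝ≥0 → Ω → ℝ) (_ : IsBrownianMotion ℱ W P)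
      (T : ℝ≥0) (_ : 0 < T) (u : ℝ≥0 → Ω → L2x),
      MemX ℱ W P b T u → MemL4 ℱ P T u ∧ l4Norm P T u ≤ C * xNorm W P b T u := by
  -- The norms increase with `b`, so `b` may be lowered to `3/8`, still above `5/16`, where the
  -- first-cell estimate is available.
  have hb' : 5 / 16 < min b (3 / 8) := lt_min hb (by norm_num)
  refine ⟨(strichartzConst (min b (3 / 8))).toNNReal, fun Ω m P _ ℱ W hW T _ u hu => ?_⟩
  obtain ⟨h1, h2⟩ := hu.mono (min_le_left b (3 / 8))
  obtain ⟨h3, h4⟩ := hW.memL4_and_l4Norm_le hb' (min_le_right _ _) h1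
  refine ⟨h3, h4.trans ?_⟩
  rw [ENNReal.coe_toNNReal (strichartzConst_ne_top hb')]
  gcongr
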